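/- **Setting.** Let $E,F$ be Polish spaces with their Borel $\sigma$-fields, and let $(P_x)_{x\in F}$ be Markov kernels on $E$ such that $(x,y)\mapsto P_x(y,A)$ is measurable for every Borel $A\subset E$. Let $X=(X_t)_{t\in\mathbb Z}$ be an $F$-valued process on a probability space $(\Omega,\mathcal A,\mathbb P)$. Assume: * *Stationarity.* The process $X$ is stationary. * *Drift.* There are measurable maps $V:E\to(0,\infty)$ and $\lambda,b:F\to[0,\infty)$ with $\mathbb E\log^+\lambda(X_0)<\infty$, $\mathbb E\log^+b(X_0)<\infty$, $\int V\,dP_x(y,\cdot)\le\lambda(x)V(y)+b(x)$ for all $(x,y)\in F\times E$, and $\limsup_{n}\big(\prod_{i=1}^n\lambda(X_{-i})\big)^{1/n}<1$ almost surely. * *Minorization.* There are a measurable map $\eta:(0,\infty)\times F\to(0,1)$ and, for every $R>0$, a probability kernel $\nu_R$ from $F$ to $E$ with $P_x(y,A)\ge\eta(R,x)\,\nu_R(x,A)$ for all $x\in F$, all $y\in E$ with $V(y)\le R$, and all Borel $A\subset E$. **Choice of the level.** For positive integers $c_1,c_2$ let $A_{(c_1,c_2)}\subset F^{\mathbb N}$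 be the set of all $(x_0,x_1,\dots)$ with $$\sup_{j\ge c_1}\prod_{i=1}^j\lambda(x_i)\le 1-\frac1{c_1},\qquad \sum_{i\ge1}\Big(\prod_{k=1}^{i-1}\lambda(x_k)\Big)b(x_i)\le c_1,\qquad \eta\big(2c_1(2c_1+1),x_0\big)\ge\frac1{c_2+1}.$$ Put $\rho_{c}=\mathbb P\big((X_0,X_{-1},X_{-2},\dots)\in A_{c}\mid X^{-1}(\mathcal I)\big)$ for $c=(c_1,c_2)$, where $\mathcal I$ is the $\sigma$-field of measurable shift-invariant subsets of $F^{\mathbb Z}$. Call a pair $C=(C_1,C_2)$ of random variables with values in the positive integers *admissible* if $\rho_{C(\omega)}(\omega)>0$ for almost every $\omega$, and then put $R(\omega)=2C_1(\omega)(2C_1(\omega)+1)$. **Coupled chains.** Fix $\omega\in\Omega$, an integer $n\ge1$ and $z,\bar z\in E$, and write $x_t=X_t(\omega)$ and $R=R(\omega)$. Let $\bar P_{n,\omega}$ be the law of the time-inhomogeneous Markov chain $(Y_t,\bar Y_t)_{t\ge-n}$ on $E\times E$ with $(Y_{-n},\bar Y_{-n})=(z,\bar z)$ and the following transition from time $t-1$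 to time $t$, started from $(y,\bar y)$: * if $y=\bar y$, then $Y_t=\bar Y_t$ is drawn from $P_{x_{t-1}}(y,\cdot)$; * if $y\ne\bar y$ and $\max(V(y),V(\bar y))>R$, then $(Y_t,\bar Y_t)$ is drawn from $P_{x_{t-1}}(y,\cdot)\otimes P_{x_{t-1}}(\bar y,\cdot)$; * if $y\ne\bar y$ and $\max(V(y),V(\bar y))\le R$, then with probability $\eta(R,x_{t-1})$ one has $Y_t=\bar Y_t$ drawn from $\nu_R(x_{t-1},\cdot)$, and with probability $1-\eta(R,x_{t-1})$ the pair is drawn from $Q_{x_{t-1}}(y,\cdot)\otimes Q_{x_{t-1}}(\bar y,\cdot)$, where $Q_x(y,A)=\dfrac{P_x(y,A)-\eta(R,x)\nu_R(x,A)}{1-\eta(R,x)}$. **Proposition.** Admissible pairs $C$ exist. For every admissible pair $C$ there are random variables $G:\Omega\to(0,\infty)$ and $\kappa:\Omega\to(0,1)$ such that, for $\mathbb P$-almost every $\omega$, for all integers $n\ge1$ and all $z,\bar z\in E$, $$\bar P_{n,\omega}\big(Y_0\neq\bar Y_0\big)\le G(\omega)\,\big(1+V(z)+V(\bar z)\big)\,\kappa(\omega)^n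 .$$ -/

import Mathlib

open MeasureTheory ProbabilityTheory Filter Topology
open scoped NNReal ENNReal

namespace RandomEnvironment

/-- The positive levels `R ∈ (0, ∞)`. -/
abbrev Level : Type := {R : ℝ≥0 // 0 < R}

section Assumptions

variable {Ω E F : Type*} [MeasurableSpace Ω] [MeasurableSpace E] [MeasurableSpace F]

/-- The process `X = (X_t)_{t ∈ ℤ}` is (strictly) stationary under `μ`: its law on `F^ℤ` is
invariant under every time shift. -/
structure IsStationary (μ : Measure Ω) (X : ℤ → Ω → F) : Prop where
  measurable : ∀ t, Measurable (X t)
  map_shift : ∀ s : ℤ, μ.map (fun ω t => X (t + s) ω) = μ.map (fun ω t => X t ω)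

/-- The drift assumption, for the kernels `P_x(y, ·) = P (x, y)`, the function `V : E → (0, ∞)` and
the coefficients `lam, b : F → [0, ∞)`. The upper limit is taken in `[0, ∞]`. -/
structure DriftAssumption (μ : Measure Ω) (X : ℤ → Ω → F) (P : Kernel (F × E) E)
    (V : E → ℝ≥0) (lam b : F → ℝ≥0) : Prop where
  measurable_V : Measurable V
  V_pos : ∀ y, 0 < V y
  measurable_lam : Measurable lam
  measurable_b : Measurable b
  integrable_log_lam : Integrable (fun ω => Real.log (max (lam (X 0 ω) : ℝ) 1)) μ
  integrable_log_b : Integrable (fun ω => Real.log (max (b (X 0 ω) : ℝ) 1)) μ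
  drift : ∀ x y, ∫⁻ u, (V u : ℝ≥0∞) ∂(P (x, y)) ≤ (lam x : ℝ≥0∞) * V y + b x
  limsup_lt_one : ∀ᵐ ω ∂μ,
    limsup (fun n : ℕ => ((∏ i ∈ Finset.Icc 1 n, lam (X (-(i : ℤ)) ω) : ℝ≥0) : ℝ≥0∞) ^
      (1 / (n : ℝ))) atTop < 1

/-- The minorization assumption: for every `R > 0`, on the level set `V⁻¹([0, R])` the kernels
`P_x` are minorized by `η(R, x) ν_R(x, ·)`, where `ν_R` is a probability kernel from `F` to `E`. -/
structure MinorizationAssumption (P : Kernel (F × E) E) (V : E → ℝ≥0)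
    (η : Level → F → ℝ≥0) (ν : Level → Kernel F E) : Prop where
  measurable_eta : Measurable (fun p : Level × F => η p.1 p.2)
  eta_pos : ∀ R x, 0 < η R x
  eta_lt_one : ∀ R x, η R x < 1
  isMarkovKernel_nu : ∀ R, IsMarkovKernel (ν R)
  minorization : ∀ (R : Level) (x : F) (y : E), V y ≤ R → ∀ A, MeasurableSet A →
    (η R x : ℝ≥0∞) * ν R x A ≤ P (x, y) A

end Assumptions

section Coupling

variable {E F : Type*} [MeasurableSpace E] [MeasurableSpace F]
  {P : Kernel (F × E) E} {V : E → ℝ≥0} {η : Level → F → ℝ≥0} {ν : Level → Kernel F E}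

theorem MinorizationAssumption.smul_le (h : MinorizationAssumption P V η ν) (R : Level) (x : F)
    {y : E} (hy : V y ≤ R) : (η R x : ℝ≥0∞) • ν R x ≤ P (x, y) := by
  refine Measure.le_iff.2 fun A hA => ?_
  simpa using h.minorization R x y hy A hA

open Classical in
/-- The residual kernel `Q_x(y, A) = (P_x(y, A) - η(R, x) ν_R(x, A)) / (1 - η(R, x))` for
`V y ≤ R`. Outside of the level set, where it is never used, it is given the value `P_x(y, ·)`. -/
noncomputable def residual [IsMarkovKernel P] (hV : Measurable V)
    (h : MinorizationAssumption P V η ν) (R : Level) (x : F) : Kernel E E :=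
  { toFun := fun y =>
      if V y ≤ R then (1 - (η R x : ℝ≥0∞))⁻¹ • (P (x, y) - (η R x : ℝ≥0∞) • ν R x)
      else P (x, y)
    measurable' := by
      have := h.isMarkovKernel_nu R
      have hm (A : Set E) (hA : MeasurableSet A) : Measurable fun y => P (x, y) A :=
        (P.measurable_coe hA).comp measurable_prodMk_left
      refine Measure.measurable_of_measurable_coe _ fun A hA => ?_
      have hfin : IsFiniteMeasure ((η R x : ℝ≥0∞) • ν R x) :=
        ⟨by simp⟩
      have heq : (fun y => (if V y ≤ R then
            (1 - (η R x : ℝ≥0∞))⁻¹ • (P (x, y) - (η R x : ℝ≥0∞) • ν R x)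
          else P (x, y)) A) = fun y => if V y ≤ R then
            (1 - (η R x : ℝ≥0∞))⁻¹ * (P (x, y) A - (η R x : ℝ≥0∞) * ν R x A)
          else P (x, y) A := by
        funext y
        by_cases hy : V y ≤ R
        · simp only [hy, if_true, Measure.smul_apply, smul_eq_mul,
            Measure.sub_apply hA (h.smul_le R x hy)]
        · simp [hy]
      rw [heq]
      exact Measurable.ite (measurableSet_le hV measurable_const)
        (((hm A hA).sub_const _).const_mul _) (hm A hA) }

theorem one_sub_eta_ne_zero (h : MinorizationAssumption P V η ν) (R : Level) (x : F) :
    1 - (η R x : ℝ≥0∞) ≠ 0 := by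
  have : (η R x : ℝ≥0∞) < 1 := by exact_mod_cast h.eta_lt_one R x
  exact (tsub_pos_of_lt this).ne'

open Classical in
instance [IsMarkovKernel P] (hV : Measurable V) (h : MinorizationAssumption P V η ν)
    (R : Level) (x : F) : IsMarkovKernel (residual hV h R x) := by
  refine ⟨fun y => ⟨?_⟩⟩
  have := h.isMarkovKernel_nu R
  have hfin : IsFiniteMeasure ((η R x : ℝ≥0∞) • ν R x) := ⟨by simp⟩
  change (if V y ≤ R then (1 - (η R x : ℝ≥0∞))⁻¹ • (P (x, y) - (η R x : ℝ≥0∞) • ν R x)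
      else P (x, y)) Set.univ = 1
  by_cases hy : V y ≤ R
  · simp only [hy, if_true, Measure.smul_apply, smul_eq_mul,
      Measure.sub_apply MeasurableSet.univ (h.smul_le R x hy), measure_univ, mul_one]
    exact ENNReal.inv_mul_cancel (one_sub_eta_ne_zero h R x) (by simp)
  · simp [hy]

variable [TopologicalSpace E] [PolishSpace E] [BorelSpace E]

open Classical in
/-- One step of the coupled chain, in the state `x` of the environment and with the level `R`.
From `(y, y')`:
* if `y = y'`, both coordinates move to the same point, drawn from `P_x(y, ·)`;
* if `y ≠ y'` and `V(y) ∨ V(y') > R`, they move independently, according to `P_x`;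
* if `y ≠ y'` and `V(y) ∨ V(y') ≤ R`, then with probability `η(R, x)` they move to the same point,
  drawn from `ν_R(x, ·)`, and otherwise they move independently, according to `Q_x`. -/
noncomputable def couplingKernel [IsMarkovKernel P] (hV : Measurable V)
    (h : MinorizationAssumption P V η ν) (R : Level) (x : F) : Kernel (E × E) (E × E) :=
  { toFun := fun p =>
      if p.1 = p.2 then (P (x, p.1)).map (fun u => (u, u))
      else if (R : ℝ≥0) < max (V p.1) (V p.2) then (P (x, p.1)).prod (P (x, p.2))
      else (η R x : ℝ≥0∞) • (ν R x).map (fun u => (u, u)) +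
        (1 - (η R x : ℝ≥0∞)) • (residual hV h R x p.1).prod (residual hV h R x p.2)
    measurable' := by
      have hprod (K : Kernel E E) [IsMarkovKernel K] :
          Measurable fun p : E × E => (K p.1).prod (K p.2) := by
        simpa only [← Kernel.parallelComp_apply] using (Kernel.parallelComp K K).measurable
      refine Measurable.ite (measurableSet_eq_fun measurable_fst measurable_snd) ?_
        (Measurable.ite (measurableSet_lt measurable_const
          ((hV.comp measurable_fst).max (hV.comp measurable_snd))) ?_ ?_)
      · exact (Measure.measurable_map _ (by fun_prop)).comp
          (P.measurable.comp (measurable_prodMk_left.comp measurable_fst))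
      · exact hprod (P.sectR x)
      · refine Measure.measurable_of_measurable_coe _ fun A hA => ?_
        simp only [Measure.add_apply, Measure.smul_apply, smul_eq_mul]
        exact (((Measure.measurable_coe hA).comp (hprod (residual hV h R x))).const_mul
          _).const_add _ }

open Classical in
instance [IsMarkovKernel P] (hV : Measurable V) (h : MinorizationAssumption P V η ν)
    (R : Level) (x : F) : IsMarkovKernel (couplingKernel hV h R x) := by
  refine ⟨fun p => ⟨?_⟩⟩
  have := h.isMarkovKernel_nu R
  have hd : Measurable fun u : E => (u, u) := by fun_prop
  have hle : (η R x : ℝ≥0∞) ≤ 1 := by exact_mod_cast (h.eta_lt_one R x).le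
  change (if p.1 = p.2 then (P (x, p.1)).map (fun u => (u, u))
      else if (R : ℝ≥0) < max (V p.1) (V p.2) then (P (x, p.1)).prod (P (x, p.2))
      else (η R x : ℝ≥0∞) • (ν R x).map (fun u => (u, u)) +
        (1 - (η R x : ℝ≥0∞)) • (residual hV h R x p.1).prod (residual hV h R x p.2))
      Set.univ = 1
  split_ifs
  · simp [Measure.map_apply hd MeasurableSet.univ]
  · simp
  · simp only [Measure.add_apply, Measure.smul_apply, smul_eq_mul, measure_univ, mul_one,
      Measure.map_apply hd MeasurableSet.univ, Set.preimage_univ]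
    exact add_tsub_cancel_of_le hle

/-- The law of the coupled chain started at `start = (z, z')`, when the successive states of the
environment are `x 0, x 1, …` and the level is `R`. It is a probability measure on the space of
trajectories; the `j`-th coordinate is the pair of states after `j` steps, and the step from `j` to
`j + 1` is governed by `couplingKernel hV h R (x j)`. -/
noncomputable def coupledLaw [IsMarkovKernel P] (hV : Measurable V)
    (h : MinorizationAssumption P V η ν) (R : Level) (x : ℕ → F) (start : E × E) :
    Measure (ℕ → E × E) :=
  Kernel.traj (X := fun _ => E × E)
    (fun j => (couplingKernel hV h R (x j)).comap
      (fun past : (Π _ : Finset.Iic j, E × E) => past ⟨j, Finset.mem_Iic.2 le_rfl⟩)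
      (measurable_pi_apply _)) 0 (fun _ => start)

/-- The law of the coupled chain `(Y_t, Y'_t)_{t ≥ -n}` started at time `-n` at `start` in the
realization `x = (x_t)_{t ∈ ℤ}` of the environment. The pair `(Y_t, Y'_t)` is the coordinate of
index `t + n`; the transition from time `t - 1` to time `t` uses `x_{t-1}`. -/
noncomputable def coupledLawFrom [IsMarkovKernel P] (hV : Measurable V)
    (h : MinorizationAssumption P V η ν) (R : Level) (x : ℤ → F) (n : ℕ) (start : E × E) :
    Measure (ℕ → E × E) :=
  coupledLaw hV h R (fun j => x (-(n : ℤ) + j)) start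

end Coupling

section LevelSelection

variable {Ω F : Type*} [MeasurableSpace Ω] [MeasurableSpace F]

/-- The level `2 c (2 c + 1)`. -/
def levelOf (c : ℕ+) : Level :=
  ⟨2 * (c : ℕ) * (2 * (c : ℕ) + 1), by have := c.pos; positivity⟩

/-- The set `A_C ⊆ F^ℕ` of the pasts `(x_0, x_1, …)` of the environment that are regular with
constants `C = (c₁, c₂)`. -/
def regularPasts (lam b : F → ℝ≥0) (η : Level → F → ℝ≥0) (c₁ c₂ : ℕ+) : Set (ℕ → F) :=
  {x | (∀ j : ℕ, (c₁ : ℕ) ≤ j →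
          ((∏ i ∈ Finset.Icc 1 j, lam (x i) : ℝ≥0) : ℝ) ≤ 1 - 1 / ((c₁ : ℕ) : ℝ)) ∧
       (∑' i : ℕ, ((∏ k ∈ Finset.Icc 1 i, lam (x k)) * b (x (i + 1)) : ℝ≥0) : ℝ≥0∞)
          ≤ ((c₁ : ℕ) : ℝ≥0∞) ∧
       1 / (((c₂ : ℕ) : ℝ) + 1) ≤ (η (levelOf c₁) (x 0) : ℝ)}

/-- The σ-algebra on `Ω` of the events `{X ∈ I}`, with `I ⊆ F^ℤ` measurable and invariant under
the shift `(x_t)_t ↦ (x_{t+1})_t`. -/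
@[reducible] def invariantEvents (X : ℤ → Ω → F) : MeasurableSpace Ω :=
  (MeasurableSpace.invariants (fun (x : ℤ → F) (t : ℤ) => x (t + 1))).comap (fun ω t => X t ω)

/-- The conditional probability that the past `(X_0, X_{-1}, …)` belongs to `A`, given the
invariant σ-algebra of the environment. -/
noncomputable def condProbPast (μ : Measure Ω) (X : ℤ → Ω → F) (A : Set (ℕ → F)) : Ω → ℝ :=
  μ⟦{ω | (fun j : ℕ => X (-(j : ℤ)) ω) ∈ A} | invariantEvents X⟧

/-- `C = (C₁, C₂)` is a random pair of positive integers such that, almost surely, the conditional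
probability `ρ_{C(ω)}(ω)` of the set of the pasts that are regular with constants `C(ω)` is
positive. -/
structure IsRegularitySelection (μ : Measure Ω) (X : ℤ → Ω → F) (lam b : F → ℝ≥0)
    (η : Level → F → ℝ≥0) (C₁ C₂ : Ω → ℕ+) : Prop where
  measurable_fst : Measurable fun ω => (C₁ ω : ℕ)
  measurable_snd : Measurable fun ω => (C₂ ω : ℕ)
  condProb_pos : ∀ᵐ ω ∂μ, 0 < condProbPast μ X (regularPasts lam b η (C₁ ω) (C₂ ω)) ω

end LevelSelection

end RandomEnvironment

/-! Fix constants `c = (c₁, c₂)` and call a time regular when the past seen from it lies in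
`regularPasts`. The proof has a deterministic half, for one realization of the environment, and an
ergodic half.

Deterministic half. The weight `Φ = 1_{y ≠ y'} (1 + ε (V y + V y'))`, with `ε = gap c₁ c₂ = 1 / (4
c₁ (c₂ + 1))`, contracts in mean by `1 - ε` between two regular times at least `c₁` apart
(`evolve_contactBound_le`). Regularity at the end of the block gives a drift with ratio at most `1 -
1/c₁` and additive constant `2 c₁`; regularity at its start gives a merging probability of at least
`1/(c₂ + 1)` in the first step. Above the level `2 c₁ (2 c₁ + 1)` the drift pays for the
contraction, below it the merging does. Keeping every `c₁`-th regular time gives a power of `1 - ε`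
that is exponential in `n` as soon as regular times have positive lower density
(`exists_coupling_bound`).

Ergodic half. Let `B` be the shift-invariant set of paths along which regular times do not have
positive lower density. The maximal ergodic theorem shows that regularity at time `0` and `B` are
almost surely incompatible (`measure_inter_sparselyVisiting`). By invariance the conditional
probability of regularity vanishes on `B`, so `ρ_c > 0` forces positive density. Admissible pairs
exist because almost every past is regular for some `c` (`ae_exists_regular`), and an event has
positive conditional probability almost everywhere it occurs. All constants depend on countably many
parameters, which makes the random choices measurable. -/

namespace RandomEnvironment

/-! ### One-step Markov property for trajectory measures. -/

section MarkovChain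

variable {Z : Type*} [MeasurableSpace Z]

/-- The kernels on the past of a Markov chain with transition kernels `κ`. -/
@[reducible] noncomputable def pastKernel (κ : ℕ → Kernel Z Z) (j : ℕ) :
    Kernel (Π _ : Finset.Iic j, Z) Z :=
  (κ j).comap (fun past => past ⟨j, Finset.mem_Iic.2 le_rfl⟩) (measurable_pi_apply _)

theorem lintegral_traj_eval_succ (κ : ℕ → Kernel Z Z) [∀ n, IsMarkovKernel (κ n)] (start : Z)
    (n : ℕ) {f : Z → ℝ≥0∞} (hf : Measurable f) :
    ∫⁻ y, f (y (n + 1)) ∂(Kernel.traj (X := fun _ => Z) (pastKernel κ) 0 fun _ => start) =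
      ∫⁻ y, ∫⁻ q, f q ∂(κ n (y n))
        ∂(Kernel.traj (X := fun _ => Z) (pastKernel κ) 0 fun _ => start) := by
  have hK : Measurable fun p => ∫⁻ q, f q ∂(κ n p) := hf.lintegral_kernel
  have hinner (w : Π _ : Finset.Iic n, Z) :
      ∫⁻ y, f (y (n + 1)) ∂(Kernel.traj (X := fun _ => Z) (pastKernel κ) n w) =
        ∫⁻ q, f q ∂(κ n (w ⟨n, Finset.mem_Iic.2 le_rfl⟩)) := by
    rw [← lintegral_map (μ := Kernel.traj (X := fun _ => Z) (pastKernel κ) n w) hf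
        (measurable_pi_apply (n + 1)),
      ← Kernel.map_apply _ (measurable_pi_apply (n + 1)), Kernel.map_traj_succ_self]
    rfl
  have hcomp := Kernel.lintegral_comp (Kernel.traj (X := fun _ => Z) (pastKernel κ) n)
    (Kernel.partialTraj (X := fun _ => Z) (pastKernel κ) 0 n) (fun _ => start)
    (g := fun y : ℕ → Z => f (y (n + 1))) (hf.comp (measurable_pi_apply _))
  rw [Kernel.traj_comp_partialTraj (Nat.zero_le n)] at hcomp
  rw [hcomp]
  simp only [hinner]
  rw [← Kernel.traj_map_frestrictLe_apply]
  exact lintegral_map (hK.comp (measurable_pi_apply (⟨n, Finset.mem_Iic.2 le_rfl⟩ : Finset.Iic n)))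
    (Preorder.measurable_frestrictLe n)

theorem lintegral_traj_eval_zero (κ : ℕ → Kernel Z Z) [∀ n, IsMarkovKernel (κ n)] (start : Z)
    {f : Z → ℝ≥0∞} (hf : Measurable f) :
    ∫⁻ y, f (y 0) ∂(Kernel.traj (X := fun _ => Z) (pastKernel κ) 0 fun _ => start) =
      f start := by
  have h0 : Measurable fun w : Π _ : Finset.Iic 0, Z => f (w ⟨0, Finset.mem_Iic.2 le_rfl⟩) :=
    hf.comp (measurable_pi_apply _)
  have := lintegral_map (μ := Kernel.traj (X := fun _ => Z) (pastKernel κ) 0 fun _ => start) h0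
    (Preorder.measurable_frestrictLe 0)
  rw [Kernel.traj_map_frestrictLe_apply, Kernel.partialTraj_self, Kernel.id_apply,
    lintegral_dirac' _ h0] at this
  exact this.symm

end MarkovChain

/-! ### Test functions on pairs: the non-meeting indicator and the summed Lyapunov function. -/

section Unmet

variable {E : Type*}

/-- The indicator function of the pairs that have not met. -/
noncomputable def unmet : E × E → ℝ≥0∞ := {p : E × E | p.1 ≠ p.2}.indicator 1

theorem unmet_of_eq {p : E × E} (hp : p.1 = p.2) : unmet p = 0 := by simp [unmet, hp]

theorem unmet_of_ne {p : E × E} (hp : p.1 ≠ p.2) : unmet p = 1 := by simp [unmet, hp]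

theorem unmet_le_one (p : E × E) : unmet p ≤ 1 := by
  by_cases hp : p.1 = p.2
  · simp [unmet_of_eq hp]
  · simp [unmet_of_ne hp]

end Unmet

section PairLyapunov

variable {E : Type*} [MeasurableSpace E] {V : E → ℝ≥0}

/-- The sum of the Lyapunov functions of the two coordinates. -/
noncomputable def pairLyapunov {E : Type*} (V : E → ℝ≥0) (p : E × E) : ℝ≥0∞ := V p.1 + V p.2

theorem measurable_pairLyapunov (hV : Measurable V) : Measurable (pairLyapunov V) := by
  unfold pairLyapunov
  fun_prop

theorem lintegral_prod_pairLyapunov (hV : Measurable V) (m₁ m₂ : Measure E)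
    [IsProbabilityMeasure m₁] [IsProbabilityMeasure m₂] :
    ∫⁻ q, pairLyapunov V q ∂(m₁.prod m₂) = ∫⁻ u, V u ∂m₁ + ∫⁻ u, V u ∂m₂ := by
  unfold pairLyapunov
  have hV' : Measurable fun u => (V u : ℝ≥0∞) := by fun_prop
  rw [lintegral_add_left (f := fun q : E × E => (V q.1 : ℝ≥0∞)) (hV'.comp measurable_fst),
    ← lintegral_map (μ := m₁.prod m₂) hV' measurable_fst,
    ← lintegral_map (μ := m₁.prod m₂) hV' measurable_snd]
  simp [Measure.map_fst_prod, Measure.map_snd_prod]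

theorem lintegral_diag_pairLyapunov (hV : Measurable V) (m : Measure E) :
    ∫⁻ q, pairLyapunov V q ∂(m.map fun u => (u, u)) = ∫⁻ u, V u ∂m + ∫⁻ u, V u ∂m := by
  have hV' : Measurable fun u => (V u : ℝ≥0∞) := by fun_prop
  rw [lintegral_map (measurable_pairLyapunov hV) (by fun_prop)]
  exact lintegral_add_left hV' _

end PairLyapunov

/-! ### One step of the coupled chain, and its iterates acting on functions. -/

section Coupling

variable {E F : Type*} [MeasurableSpace E] [MeasurableSpace F]
  {P : Kernel (F × E) E} [IsMarkovKernel P] {V : E → ℝ≥0} {η : Level → F → ℝ≥0}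
  {ν : Level → Kernel F E}

/-- This splitting is why both coordinates keep the marginal transition `P` in the merging regime,
so that the drift survives the coupling. -/
theorem smul_nu_add_smul_residual (hV : Measurable V) (h : MinorizationAssumption P V η ν)
    (R : Level) (x : F) {y : E} (hy : V y ≤ R) :
    (η R x : ℝ≥0∞) • ν R x + (1 - (η R x : ℝ≥0∞)) • residual hV h R x y = P (x, y) := by
  have := h.isMarkovKernel_nu R
  have hfin : IsFiniteMeasure ((η R x : ℝ≥0∞) • ν R x) := ⟨by simp⟩
  have hres : residual hV h R x y =
      (1 - (η R x : ℝ≥0∞))⁻¹ • (P (x, y) - (η R x : ℝ≥0∞) • ν R x) := if_pos hy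
  rw [hres, smul_smul, ENNReal.mul_inv_cancel (one_sub_eta_ne_zero h R x) (by simp), one_smul,
    add_comm, Measure.sub_add_cancel_of_le (h.smul_le R x hy)]

variable [TopologicalSpace E] [PolishSpace E] [BorelSpace E]

theorem measurableSet_ne : MeasurableSet {p : E × E | p.1 ≠ p.2} :=
  (measurableSet_eq_fun measurable_fst measurable_snd).compl

theorem measurable_unmet : Measurable (unmet : E × E → ℝ≥0∞) :=
  measurable_one.indicator measurableSet_ne

theorem lintegral_diag_unmet (m : Measure E) :
    ∫⁻ q, unmet q ∂(m.map fun u => (u, u)) = 0 := by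
  rw [lintegral_map measurable_unmet (by fun_prop)]
  simp [unmet_of_eq]

theorem couplingKernel_apply_of_eq (hV : Measurable V) (h : MinorizationAssumption P V η ν)
    (R : Level) (x : F) {p : E × E} (hp : p.1 = p.2) :
    couplingKernel hV h R x p = (P (x, p.1)).map (fun u => (u, u)) := if_pos hp

theorem couplingKernel_apply_of_lt (hV : Measurable V) (h : MinorizationAssumption P V η ν)
    (R : Level) (x : F) {p : E × E} (hp : p.1 ≠ p.2) (hR : (R : ℝ≥0) < max (V p.1) (V p.2)) :
    couplingKernel hV h R x p = (P (x, p.1)).prod (P (x, p.2)) :=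
  (if_neg hp).trans (if_pos hR)

theorem couplingKernel_apply_of_le (hV : Measurable V) (h : MinorizationAssumption P V η ν)
    (R : Level) (x : F) {p : E × E} (hp : p.1 ≠ p.2) (hR : max (V p.1) (V p.2) ≤ (R : ℝ≥0)) :
    couplingKernel hV h R x p = (η R x : ℝ≥0∞) • (ν R x).map (fun u => (u, u)) +
        (1 - (η R x : ℝ≥0∞)) • (residual hV h R x p.1).prod (residual hV h R x p.2) :=
  (if_neg hp).trans (if_neg hR.not_gt)

/-- The coordinates of the coupled chain move according to `P`, as far as `V` can see. -/
theorem lintegral_couplingKernel_pairLyapunov (hV : Measurable V)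
    (h : MinorizationAssumption P V η ν) (R : Level) (x : F) (p : E × E) :
    ∫⁻ q, pairLyapunov V q ∂(couplingKernel hV h R x p) =
      ∫⁻ u, V u ∂(P (x, p.1)) + ∫⁻ u, V u ∂(P (x, p.2)) := by
  have := h.isMarkovKernel_nu R
  by_cases hp : p.1 = p.2
  · rw [couplingKernel_apply_of_eq hV h R x hp, lintegral_diag_pairLyapunov hV, hp]
  rcases lt_or_ge (R : ℝ≥0) (max (V p.1) (V p.2)) with hR | hR
  · rw [couplingKernel_apply_of_lt hV h R x hp hR, lintegral_prod_pairLyapunov hV]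
  · rw [couplingKernel_apply_of_le hV h R x hp hR, lintegral_add_measure, lintegral_smul_measure,
      lintegral_smul_measure, lintegral_prod_pairLyapunov hV, lintegral_diag_pairLyapunov hV,
      ← smul_nu_add_smul_residual hV h R x ((le_max_left _ _).trans hR),
      ← smul_nu_add_smul_residual hV h R x ((le_max_right _ _).trans hR)]
    simp only [lintegral_add_measure, lintegral_smul_measure, smul_add]
    abel

theorem lintegral_couplingKernel_pairLyapunov_le {lam b : F → ℝ≥0} (hV : Measurable V)
    (h : MinorizationAssumption P V η ν) (R : Level) (x : F) (p : E × E)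
    (hd : ∀ x y, ∫⁻ u, (V u : ℝ≥0∞) ∂(P (x, y)) ≤ (lam x : ℝ≥0∞) * V y + b x) :
    ∫⁻ q, pairLyapunov V q ∂(couplingKernel hV h R x p) ≤
      lam x * pairLyapunov V p + 2 * b x := by
  rw [lintegral_couplingKernel_pairLyapunov]
  refine (add_le_add (hd _ _) (hd _ _)).trans_eq ?_
  unfold pairLyapunov
  ring

theorem lintegral_couplingKernel_unmet_le (hV : Measurable V)
    (h : MinorizationAssumption P V η ν) (R : Level) (x : F) (p : E × E) :
    ∫⁻ q, unmet q ∂(couplingKernel hV h R x p) ≤ unmet p := by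
  by_cases hp : p.1 = p.2
  · rw [couplingKernel_apply_of_eq hV h R x hp, lintegral_diag_unmet]
    exact zero_le
  · rw [unmet_of_ne hp]
    exact (lintegral_mono unmet_le_one).trans (by simp)

theorem lintegral_couplingKernel_unmet_le_of_le (hV : Measurable V)
    (h : MinorizationAssumption P V η ν) (R : Level) (x : F) {p : E × E}
    (hR : max (V p.1) (V p.2) ≤ (R : ℝ≥0)) :
    ∫⁻ q, unmet q ∂(couplingKernel hV h R x p) ≤ 1 - (η R x : ℝ≥0∞) := by
  by_cases hp : p.1 = p.2
  · rw [couplingKernel_apply_of_eq hV h R x hp, lintegral_diag_unmet]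
    exact zero_le
  · rw [couplingKernel_apply_of_le hV h R x hp hR, lintegral_add_measure, lintegral_smul_measure,
      lintegral_smul_measure, lintegral_diag_unmet, smul_zero, zero_add, smul_eq_mul]
    exact mul_le_of_le_one_right' ((lintegral_mono unmet_le_one).trans (by simp))

/-- The expectation of `f` after `k` steps of the coupled chain that starts at time `s`, as a
function of the starting point. -/
noncomputable def evolve (hV : Measurable V) (h : MinorizationAssumption P V η ν) (R : Level)
    (z : ℤ → F) (s : ℤ) : ℕ → (E × E → ℝ≥0∞) → E × E → ℝ≥0∞
  | 0, f => f
  | k + 1, f => evolve hV h R z s k fun p => ∫⁻ q, f q ∂(couplingKernel hV h R (z (s + k)) p)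

section Evolve

variable (hV : Measurable V) (h : MinorizationAssumption P V η ν) (R : Level) (z : ℤ → F)

theorem evolve_mono (s : ℤ) (k : ℕ) {f g : E × E → ℝ≥0∞} (hfg : ∀ p, f p ≤ g p) (p : E × E) :
    evolve hV h R z s k f p ≤ evolve hV h R z s k g p := by
  induction k generalizing f g with
  | zero => exact hfg p
  | succ k ih => exact ih fun p => lintegral_mono hfg

theorem evolve_add_steps (s : ℤ) (m k : ℕ) (f : E × E → ℝ≥0∞) :
    evolve hV h R z s (m + k) f = evolve hV h R z s m (evolve hV h R z (s + m) k f) := by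
  induction k generalizing f with
  | zero => rfl
  | succ k ih =>
    rw [← add_assoc, evolve, ih, evolve]
    push_cast
    simp only [add_assoc]

theorem evolve_const (s : ℤ) (k : ℕ) (c : ℝ≥0∞) (p : E × E) :
    evolve hV h R z s k (fun _ => c) p = c := by
  induction k with
  | zero => rfl
  | succ k ih => simpa [evolve] using ih

theorem measurable_lintegral_couplingKernel (x : F) {f : E × E → ℝ≥0∞} (hf : Measurable f) :
    Measurable fun p => ∫⁻ q, f q ∂(couplingKernel hV h R x p) := hf.lintegral_kernel

theorem evolve_add (s : ℤ) (k : ℕ) {f : E × E → ℝ≥0∞} (hf : Measurable f) (g : E × E → ℝ≥0∞)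
    (p : E × E) :
    evolve hV h R z s k (fun q => f q + g q) p =
      evolve hV h R z s k f p + evolve hV h R z s k g p := by
  induction k generalizing f g with
  | zero => rfl
  | succ k ih =>
    simp only [evolve, lintegral_add_left hf]
    exact ih (measurable_lintegral_couplingKernel hV h R _ hf) _

theorem evolve_const_mul (s : ℤ) (k : ℕ) (c : ℝ≥0∞) {f : E × E → ℝ≥0∞} (hf : Measurable f)
    (p : E × E) :
    evolve hV h R z s k (fun q => c * f q) p = c * evolve hV h R z s k f p := by
  induction k generalizing f with
  | zero => rfl
  | succ k ih =>
    simp only [evolve, lintegral_const_mul c hf]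
    exact ih (measurable_lintegral_couplingKernel hV h R _ hf)

theorem evolve_unmet_le (s : ℤ) (k : ℕ) (p : E × E) :
    evolve hV h R z s k unmet p ≤ unmet p := by
  induction k with
  | zero => rfl
  | succ k ih =>
    exact (evolve_mono hV h R z s k (lintegral_couplingKernel_unmet_le hV h R _) p).trans ih

/-- Unrolls the drift from the last step. Indices count backwards from the final time `s + k`, the
form in which regularity of the past at `s + k` applies. -/
theorem evolve_pairLyapunov_le {lam b : F → ℝ≥0}
    (hd : ∀ x y, ∫⁻ u, (V u : ℝ≥0∞) ∂(P (x, y)) ≤ (lam x : ℝ≥0∞) * V y + b x)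
    (s : ℤ) (k : ℕ) (p : E × E) :
    evolve hV h R z s k (pairLyapunov V) p ≤
      ((∏ i ∈ Finset.range k, lam (z (s + k - (i + 1 : ℕ))) : ℝ≥0) : ℝ≥0∞) * pairLyapunov V p +
        2 * ∑ i ∈ Finset.range k, (((∏ j ∈ Finset.range i, lam (z (s + k - (j + 1 : ℕ)))) *
          b (z (s + k - (i + 1 : ℕ))) : ℝ≥0) : ℝ≥0∞) := by
  induction k with
  | zero => simp [evolve]
  | succ k ih =>
    have hstep := evolve_mono hV h R z s k
      (fun p => lintegral_couplingKernel_pairLyapunov_le hV h R (z (s + k)) p hd) p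
    rw [evolve_add hV h R z s k ((measurable_pairLyapunov hV).const_mul _),
      evolve_const_mul hV h R z s k _ (measurable_pairLyapunov hV), evolve_const] at hstep
    refine hstep.trans ((add_le_add_left (mul_le_mul_right ih _) _).trans_eq ?_)
    have h1 : ∀ i : ℕ, s + ((k + 1 : ℕ) : ℤ) - ((i + 1 + 1 : ℕ) : ℤ) = s + k - (i + 1 : ℕ) := by
      intro i; push_cast; ring
    have h0 : s + ((k + 1 : ℕ) : ℤ) - ((0 + 1 : ℕ) : ℤ) = s + k := by push_cast; ring
    simp only [Finset.prod_range_succ', Finset.sum_range_succ', h1, h0]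
    push_cast
    simp only [Finset.prod_range_zero, one_mul]
    rw [mul_add, mul_add, ← mul_assoc, mul_comm (lam (z (s + k)) : ℝ≥0∞) (∏ i ∈ _, _), add_assoc]
    congr 1
    congr 1
    rw [mul_left_comm, Finset.mul_sum]
    congr 1
    refine Finset.sum_congr rfl fun i _ => ?_
    ring

/-- Both sides peel off the last transition. From here on `evolve` replaces the trajectory measure.
-/
theorem lintegral_coupledLawFrom (n k : ℕ) (start : E × E) {f : E × E → ℝ≥0∞}
    (hf : Measurable f) :
    ∫⁻ y, f (y k) ∂(coupledLawFrom hV h R z n start) = evolve hV h R z (-n) k f start := by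
  induction k generalizing f with
  | zero => exact lintegral_traj_eval_zero _ start hf
  | succ k ih =>
    refine (lintegral_traj_eval_succ _ start k hf).trans ?_
    exact ih (measurable_lintegral_couplingKernel hV h R _ hf)

theorem coupledLawFrom_ne (n : ℕ) (start : E × E) :
    coupledLawFrom hV h R z n start {y | (y n).1 ≠ (y n).2} =
      evolve hV h R z (-n) n unmet start := by
  rw [← lintegral_coupledLawFrom hV h R z n n start measurable_unmet]
  exact (lintegral_indicator_one (measurableSet_ne.preimage (measurable_pi_apply n))).symm

end Evolve

end Coupling

/-! ### Contraction of the weight between two regular times. -/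

section Contraction

/-- The past of the sequence `z` as seen from time `t`. -/
def pastAt {F : Type*} (z : ℤ → F) (t : ℤ) : ℕ → F := fun j => z (t - j)

/-- The contraction gap between two regular times. -/
noncomputable def gap (c₁ c₂ : ℕ+) : ℝ≥0 := 1 / (4 * (c₁ : ℕ) * ((c₂ : ℕ) + 1))

theorem gap_pos (c₁ c₂ : ℕ+) : 0 < gap c₁ c₂ := by
  have := c₁.pos
  unfold gap
  positivity

theorem gap_mul (c₁ c₂ : ℕ+) :
    (gap c₁ c₂ : ℝ) * (4 * (c₁ : ℕ) * ((c₂ : ℕ) + 1)) = 1 := by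
  have : (0 : ℝ) < (c₁ : ℕ) := by exact_mod_cast c₁.pos
  unfold gap
  push_cast
  field_simp

theorem gap_lt_one (c₁ c₂ : ℕ+) : gap c₁ c₂ < 1 := by
  have h1 : (1 : ℝ) ≤ (c₁ : ℕ) := by exact_mod_cast c₁.pos
  have h2 : (1 : ℝ) ≤ (c₂ : ℕ) := by exact_mod_cast c₂.pos
  have h := gap_mul c₁ c₂
  have h0 : (0 : ℝ) < gap c₁ c₂ := gap_pos c₁ c₂
  rw [← NNReal.coe_lt_coe, NNReal.coe_one]
  nlinarith [mul_le_mul h1 h2 zero_le_one (by positivity)]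

/-- Below the level, with `d = c₂ + 1` and `e` the gap: half of the merging gain `1/d` pays for `2
c₁ e = 1/(2d)`, the other half for `e` itself. The term in `w` is harmless since `r ≤ 1 - 1/c₁ ≤ 1 -
e`. -/
theorem contraction_of_le (c₁ c₂ : ℕ+) {r w : ℝ} (hr : r ≤ 1 - 1 / ((c₁ : ℕ) : ℝ)) (hw : 0 ≤ w) :
    1 - 1 / (((c₂ : ℕ) : ℝ) + 1) + gap c₁ c₂ * (r * w + 2 * (c₁ : ℕ)) ≤
      (1 - gap c₁ c₂) * (1 + gap c₁ c₂ * w) := by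
  have h1 : (1 : ℝ) ≤ (c₁ : ℕ) := by exact_mod_cast c₁.pos
  have h2 : (1 : ℝ) ≤ (c₂ : ℕ) := by exact_mod_cast c₂.pos
  have hg : (gap c₁ c₂ : ℝ) = 1 / (4 * (c₁ : ℕ) * ((c₂ : ℕ) + 1)) := by unfold gap; push_cast; rfl
  have h0 : (0 : ℝ) < gap c₁ c₂ := gap_pos c₁ c₂
  set e : ℝ := (gap c₁ c₂ : ℝ)
  set c : ℝ := ((c₁ : ℕ) : ℝ)
  set d : ℝ := ((c₂ : ℕ) : ℝ) + 1
  have hd : 1 ≤ d := by linarith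
  have hec : e ≤ 1 / c := by
    rw [hg]; apply one_div_le_one_div_of_le (by linarith); nlinarith
  have hcd : 2 * c * e = 1 / d / 2 := by rw [hg]; field_simp; norm_num
  have hed : e ≤ 1 / d / 2 := by
    rw [← hcd]; nlinarith
  have h3 : 0 ≤ e * w * (1 - e - r) := by
    apply mul_nonneg (by positivity); linarith
  nlinarith

/-- Above the level there is no merging gain. Since `1 - e - r ≥ 1/(2 c₁)`, the drift gains `e w /
(2 c₁)`, which must cover `e (2 c₁ + 1)`: hence the level `2 c₁ (2 c₁ + 1)`. -/
theorem contraction_of_lt (c₁ c₂ : ℕ+) {r w : ℝ} (hr : r ≤ 1 - 1 / ((c₁ : ℕ) : ℝ))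
    (hw : 2 * ((c₁ : ℕ) : ℝ) * (2 * (c₁ : ℕ) + 1) ≤ w) :
    1 + gap c₁ c₂ * (r * w + 2 * (c₁ : ℕ)) ≤ (1 - gap c₁ c₂) * (1 + gap c₁ c₂ * w) := by
  have h1 : (1 : ℝ) ≤ (c₁ : ℕ) := by exact_mod_cast c₁.pos
  have h2 : (1 : ℝ) ≤ (c₂ : ℕ) := by exact_mod_cast c₂.pos
  have hg : (gap c₁ c₂ : ℝ) = 1 / (4 * (c₁ : ℕ) * ((c₂ : ℕ) + 1)) := by unfold gap; push_cast; rfl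
  have h0 : (0 : ℝ) < gap c₁ c₂ := gap_pos c₁ c₂
  set e : ℝ := (gap c₁ c₂ : ℝ)
  set c : ℝ := ((c₁ : ℕ) : ℝ)
  set d : ℝ := ((c₂ : ℕ) : ℝ) + 1
  have hd : 1 ≤ d := by linarith
  have hec : e ≤ 1 / (2 * c) := by
    rw [hg]; apply one_div_le_one_div_of_le (by linarith); nlinarith
  have hcc : 1 / c = 2 * (1 / (2 * c)) := by field_simp
  have h3 : 2 * c + 1 ≤ w * (1 - e - r) := by
    have h4 : 1 / (2 * c) ≤ 1 - e - r := by linarith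
    calc 2 * c + 1 = 2 * c * (2 * c + 1) * (1 / (2 * c)) := by field_simp
      _ ≤ w * (1 - e - r) := mul_le_mul hw h4 (by positivity) (le_trans (by positivity) hw)
  nlinarith [mul_le_mul_of_nonneg_left h3 h0.le]

variable {E F : Type*} [MeasurableSpace E] [MeasurableSpace F]
  {P : Kernel (F × E) E} [IsMarkovKernel P] {V : E → ℝ≥0} {η : Level → F → ℝ≥0}
  {ν : Level → Kernel F E} {lam b : F → ℝ≥0}

theorem prod_range_succ_index {M : Type*} [CommMonoid M] (f : ℕ → M) (k : ℕ) :
    ∏ i ∈ Finset.range k, f (i + 1) = ∏ i ∈ Finset.Icc 1 k, f i := by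
  rw [Finset.range_eq_Ico, Finset.prod_Ico_add' f 0 k 1]
  rfl

variable [TopologicalSpace E] [PolishSpace E] [BorelSpace E]
  (hV : Measurable V) (h : MinorizationAssumption P V η ν) (R : Level) (z : ℤ → F)

/-- Only the final time has to be regular. Its series bound dominates the finite sum of additive
terms, doubled because there are two coordinates. -/
theorem evolve_pairLyapunov_le_of_regular {c₁ c₂ : ℕ+}
    (hd : ∀ x y, ∫⁻ u, (V u : ℝ≥0∞) ∂(P (x, y)) ≤ (lam x : ℝ≥0∞) * V y + b x)
    {s : ℤ} {k : ℕ} (hk : (c₁ : ℕ) ≤ k)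
    (hreg : pastAt z (s + k) ∈ regularPasts lam b η c₁ c₂) :
    ∃ r : ℝ≥0, (r : ℝ) ≤ 1 - 1 / ((c₁ : ℕ) : ℝ) ∧ ∀ p,
      evolve hV h R z s k (pairLyapunov V) p ≤ r * pairLyapunov V p + 2 * (c₁ : ℕ) := by
  refine ⟨_, hreg.1 k hk, fun p => (evolve_pairLyapunov_le hV h R z hd s k p).trans ?_⟩
  have hprod (i : ℕ) : ∏ j ∈ Finset.range i, lam (z (s + k - (j + 1 : ℕ))) =
      ∏ j ∈ Finset.Icc 1 i, lam (pastAt z (s + k) j) :=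
    prod_range_succ_index (fun j => lam (pastAt z (s + k) j)) i
  simp only [hprod]
  gcongr
  exact (ENNReal.sum_le_tsum _).trans hreg.2.1

/-- The Lyapunov function of the pairs that have not met. -/
noncomputable def contactBound (V : E → ℝ≥0) (e : ℝ≥0) (p : E × E) : ℝ≥0∞ :=
  unmet p * (1 + e * pairLyapunov V p)

theorem evolve_contactBound_le_add (e : ℝ≥0) (s : ℤ) (k : ℕ) (p : E × E) :
    evolve hV h R z s k (contactBound V e) p ≤
      evolve hV h R z s k unmet p + e * evolve hV h R z s k (pairLyapunov V) p := by
  rw [← evolve_const_mul hV h R z s k _ (measurable_pairLyapunov hV),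
    ← evolve_add hV h R z s k measurable_unmet]
  refine evolve_mono hV h R z s k (fun q => ?_) p
  rw [contactBound, mul_add, mul_one]
  exact add_le_add le_rfl (mul_le_of_le_one_left' (unmet_le_one q))

theorem evolve_contactBound_of_eq (e : ℝ≥0) (s : ℤ) (k : ℕ) {p : E × E} (hp : p.1 = p.2) :
    evolve hV h R z s k (contactBound V e) p = 0 := by
  -- The factor `⊤` is affordable because `⊤ * 0 = 0` and a merged pair never separates.
  have h1 : evolve hV h R z s k (contactBound V e) p ≤
      evolve hV h R z s k (fun q => ⊤ * unmet q) p := by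
    refine evolve_mono hV h R z s k (fun q => ?_) p
    rw [contactBound, mul_comm]
    gcongr
    exact le_top
  rw [evolve_const_mul hV h R z s k _ measurable_unmet] at h1
  have h2 := evolve_unmet_le hV h R z s k p
  rw [unmet_of_eq hp, nonpos_iff_eq_zero] at h2
  rw [h2, mul_zero] at h1
  exact nonpos_iff_eq_zero.1 h1

theorem evolve_unmet_le_of_le (s : ℤ) {k : ℕ} (hk : 1 ≤ k) {p : E × E}
    (hR : max (V p.1) (V p.2) ≤ (R : ℝ≥0)) :
    evolve hV h R z s k unmet p ≤ 1 - (η R (z s) : ℝ≥0∞) := by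
  obtain ⟨k, rfl⟩ := Nat.exists_eq_add_of_le hk
  rw [evolve_add_steps]
  refine (evolve_mono hV h R z s 1 (evolve_unmet_le hV h R z _ k) p).trans ?_
  simpa [evolve] using lintegral_couplingKernel_unmet_le_of_le hV h R (z s) hR

/-- The two regularity hypotheses play different roles: `hreg` (end) controls the drift over the
block, `hreg'` (start) bounds `η` below in the first step, whose environment is `z s`. -/
theorem evolve_contactBound_le {c₁ c₂ : ℕ+}
    (hd : ∀ x y, ∫⁻ u, (V u : ℝ≥0∞) ∂(P (x, y)) ≤ (lam x : ℝ≥0∞) * V y + b x)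
    {s : ℤ} {k : ℕ} (hk : (c₁ : ℕ) ≤ k)
    (hreg : pastAt z (s + k) ∈ regularPasts lam b η c₁ c₂)
    (hreg' : pastAt z s ∈ regularPasts lam b η c₁ c₂) (p : E × E) :
    evolve hV h (levelOf c₁) z s k (contactBound V (gap c₁ c₂)) p ≤
      ((1 - gap c₁ c₂ : ℝ≥0) : ℝ≥0∞) * contactBound V (gap c₁ c₂) p := by
  by_cases hp : p.1 = p.2
  · rw [evolve_contactBound_of_eq hV h _ z _ s k hp]
    exact zero_le
  obtain ⟨r, hr, hW⟩ := evolve_pairLyapunov_le_of_regular hV h (levelOf c₁) z hd hk hreg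
  have hWp : pairLyapunov V p = ((V p.1 + V p.2 : ℝ≥0) : ℝ≥0∞) := by simp [pairLyapunov]
  have hΦ : contactBound V (gap c₁ c₂) p =
      ((1 + gap c₁ c₂ * (V p.1 + V p.2) : ℝ≥0) : ℝ≥0∞) := by
    simp [contactBound, unmet_of_ne hp, pairLyapunov]
  have hg1 := (gap_lt_one c₁ c₂).le
  have key (a : ℝ≥0) (ha : evolve hV h (levelOf c₁) z s k unmet p ≤ a)
      (hle : (a : ℝ) + gap c₁ c₂ * (r * (V p.1 + V p.2) + 2 * (c₁ : ℕ)) ≤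
        (1 - gap c₁ c₂) * (1 + gap c₁ c₂ * (V p.1 + V p.2))) :
      evolve hV h (levelOf c₁) z s k (contactBound V (gap c₁ c₂)) p ≤
        ((1 - gap c₁ c₂ : ℝ≥0) : ℝ≥0∞) * contactBound V (gap c₁ c₂) p := by
    refine (evolve_contactBound_le_add hV h _ z _ s k p).trans
      ((add_le_add ha (mul_le_mul_right (hW p) _)).trans ?_)
    rw [hΦ, hWp]
    have : a + gap c₁ c₂ * (r * (V p.1 + V p.2) + 2 * (c₁ : ℕ)) ≤
        (1 - gap c₁ c₂) * (1 + gap c₁ c₂ * (V p.1 + V p.2)) := by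
      rw [← NNReal.coe_le_coe]
      push_cast [NNReal.coe_sub hg1]
      exact hle
    exact_mod_cast this
  rcases lt_or_ge ((levelOf c₁ : Level) : ℝ≥0) (max (V p.1) (V p.2)) with hR | hR
  · refine key 1 ((evolve_unmet_le hV h _ z s k p).trans (unmet_le_one p)) ?_
    refine contraction_of_lt c₁ c₂ hr ?_
    have h1 : ((levelOf c₁ : Level) : ℝ≥0) ≤ V p.1 + V p.2 :=
      hR.le.trans (max_le (by simp) (by simp))
    have h2 := NNReal.coe_le_coe.2 h1
    simpa [levelOf] using h2
  · have hη := (h.eta_lt_one (levelOf c₁) (z s)).le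
    refine key (1 - η (levelOf c₁) (z s)) ?_ ?_
    · exact_mod_cast evolve_unmet_le_of_le hV h _ z s (c₁.pos.trans_le hk) hR
    · refine le_trans ?_ (contraction_of_le c₁ c₂ hr (w := V p.1 + V p.2) (by positivity))
      have h3 := hreg'.2.2
      simp only [pastAt, Nat.cast_zero, sub_zero] at h3
      push_cast [NNReal.coe_sub hη]
      linarith

end Contraction

/-! ### Locating a regular time by its rank. -/

section Counting

theorem exists_lt_count_eq (p : ℕ → Prop) [DecidablePred p] {N n : ℕ} (h : N < Nat.count p n) :
    ∃ m < n, p m ∧ Nat.count p m = N := by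
  induction n with
  | zero => simp at h
  | succ n ih =>
    rw [Nat.count_succ] at h
    by_cases hN : N < Nat.count p n
    · obtain ⟨m, hm, h'⟩ := ih hN
      exact ⟨m, by omega, h'⟩
    · by_cases hp : p n
      · exact ⟨n, by omega, hp, by simp [hp] at h; omega⟩
      · simp [hp] at h; omega

theorem count_le_count_add_sub (p : ℕ → Prop) [DecidablePred p] {m n : ℕ} (h : m ≤ n) :
    Nat.count p n ≤ Nat.count p m + (n - m) := by
  obtain ⟨k, rfl⟩ := Nat.exists_eq_add_of_le h
  rw [Nat.count_add]
  have := Nat.count_le (p := fun j => p (m + j)) (n := k)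
  omega

end Counting

/-! ### From many regular times to exponential decay. -/

section Iteration

variable {E F : Type*} [MeasurableSpace E] [MeasurableSpace F]
  {P : Kernel (F × E) E} [IsMarkovKernel P] {V : E → ℝ≥0} {η : Level → F → ℝ≥0}
  {ν : Level → Kernel F E} {lam b : F → ℝ≥0} {c₁ c₂ : ℕ+}
  [TopologicalSpace E] [PolishSpace E] [BorelSpace E]
  (hV : Measurable V) (h : MinorizationAssumption P V η ν) (z : ℤ → F)

theorem evolve_unmet_split (R : Level) {m n : ℕ} (hmn : m ≤ n) {f : E × E → ℝ≥0∞}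
    (hf : ∀ q, evolve hV h R z (-m) m unmet q ≤ f q) (p : E × E) :
    evolve hV h R z (-n) n unmet p ≤ evolve hV h R z (-n) (n - m) f p := by
  have h1 : evolve hV h R z (-n) (n - m + m) unmet p ≤ evolve hV h R z (-n) (n - m) f p := by
    rw [evolve_add_steps]
    refine evolve_mono hV h R z _ _ (fun q => ?_) p
    have : -(n : ℤ) + ((n - m : ℕ) : ℤ) = -m := by omega
    rw [this]
    exact hf q
  rwa [Nat.sub_add_cancel hmn] at h1

theorem measurable_contactBound (e : ℝ≥0) (hV : Measurable V) : Measurable (contactBound V e) :=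
  measurable_unmet.mul (((measurable_pairLyapunov hV).const_mul _).const_add _)

/-- Time is `-n`, so a smaller index is a later time. The induction jumps to the regular index `m <
n` of rank `c₁ k`; the rank drops by `c₁`, so the block has length at least `c₁` and one contraction
applies. -/
theorem evolve_unmet_le_pow_of_count_eq
    (hd : ∀ x y, ∫⁻ u, (V u : ℝ≥0∞) ∂(P (x, y)) ≤ (lam x : ℝ≥0∞) * V y + b x)
    (reg : ℕ → Prop) [DecidablePred reg]
    (hreg : ∀ m : ℕ, reg m → pastAt z (-m) ∈ regularPasts lam b η c₁ c₂)
    (k n : ℕ) (hn : reg n) (hk : Nat.count reg n = c₁ * k) (p : E × E) :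
    evolve hV h (levelOf c₁) z (-n) n unmet p ≤
      ((1 - gap c₁ c₂ : ℝ≥0) : ℝ≥0∞) ^ k * contactBound V (gap c₁ c₂) p := by
  induction k generalizing n p with
  | zero =>
    rw [pow_zero, one_mul]
    refine (evolve_unmet_le hV h _ z _ _ p).trans ?_
    exact le_mul_of_one_le_right' le_self_add
  | succ k ih =>
    have hlt : (c₁ : ℕ) * k < Nat.count reg n := by
      rw [hk]; exact Nat.mul_lt_mul_of_pos_left (Nat.lt_succ_self k) c₁.pos
    obtain ⟨m, hmn, hm, hmk⟩ := exists_lt_count_eq reg hlt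
    have hc := count_le_count_add_sub reg hmn.le
    have hcn : (c₁ : ℕ) ≤ n - m := by rw [hk, hmk, mul_add] at hc; omega
    refine (evolve_unmet_split hV h z _ hmn.le (ih m hm hmk) p).trans ?_
    rw [evolve_const_mul hV h _ z _ _ _ (measurable_contactBound _ hV), pow_succ, mul_assoc]
    gcongr
    have hnm : -(n : ℤ) + ((n - m : ℕ) : ℤ) = -m := by omega
    exact evolve_contactBound_le hV h z hd hcn (hnm ▸ hreg m hm) (hreg n hn) p

/-- Here the starting time need not be regular. Its first stretch uses the drift alone, at the price
of the factor `1 + 2 c₁`; the `c₁` visits in excess of `c₁ k` make that stretch long enough for the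
drift bound. -/
theorem evolve_unmet_le_pow
    (hd : ∀ x y, ∫⁻ u, (V u : ℝ≥0∞) ∂(P (x, y)) ≤ (lam x : ℝ≥0∞) * V y + b x)
    (reg : ℕ → Prop) [DecidablePred reg]
    (hreg : ∀ m : ℕ, reg m → pastAt z (-m) ∈ regularPasts lam b η c₁ c₂)
    (k n : ℕ) (hk : c₁ * (k + 1) ≤ Nat.count reg n) (p : E × E) :
    evolve hV h (levelOf c₁) z (-n) n unmet p ≤
      ((1 - gap c₁ c₂ : ℝ≥0) : ℝ≥0∞) ^ k * ((1 + 2 * (c₁ : ℕ)) * (1 + pairLyapunov V p)) := by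
  have hlt : (c₁ : ℕ) * k < Nat.count reg n :=
    (Nat.mul_lt_mul_of_pos_left (Nat.lt_succ_self k) c₁.pos).trans_le hk
  obtain ⟨m, hmn, hm, hmk⟩ := exists_lt_count_eq reg hlt
  have hc := count_le_count_add_sub reg hmn.le
  have hcn : (c₁ : ℕ) ≤ n - m := by rw [hmk] at hc; rw [mul_add] at hk; omega
  have hnm : -(n : ℤ) + ((n - m : ℕ) : ℤ) = -m := by omega
  refine (evolve_unmet_split hV h z _ hmn.le
    (evolve_unmet_le_pow_of_count_eq hV h z hd reg hreg k m hm hmk) p).trans ?_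
  rw [evolve_const_mul hV h _ z _ _ _ (measurable_contactBound _ hV)]
  gcongr
  refine (evolve_contactBound_le_add hV h _ z _ _ _ p).trans ?_
  obtain ⟨r, hr, hW⟩ := evolve_pairLyapunov_le_of_regular hV h (levelOf c₁) z hd hcn
    (hnm ▸ hreg m hm)
  have hr1 : (r : ℝ≥0∞) ≤ 1 := by
    have : (0 : ℝ) ≤ 1 / ((c₁ : ℕ) : ℝ) := by positivity
    exact_mod_cast (by linarith : (r : ℝ) ≤ 1)
  have hg1 : (gap c₁ c₂ : ℝ≥0∞) ≤ 1 := by exact_mod_cast (gap_lt_one c₁ c₂).le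
  calc evolve hV h (levelOf c₁) z (-n) (n - m) unmet p + gap c₁ c₂ *
        evolve hV h (levelOf c₁) z (-n) (n - m) (pairLyapunov V) p
      ≤ 1 + 1 * (1 * pairLyapunov V p + 2 * (c₁ : ℕ)) := by
        gcongr
        · exact (evolve_unmet_le hV h _ z _ _ p).trans (unmet_le_one p)
        · refine (hW p).trans ?_
          gcongr
    _ ≤ 1 + 1 * (1 * pairLyapunov V p + 2 * (c₁ : ℕ)) +
          2 * (c₁ : ℕ) * pairLyapunov V p := le_self_add
    _ = (1 + 2 * (c₁ : ℕ)) * (1 + pairLyapunov V p) := by ring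

/-- If regular times have a positive lower density, with explicit constants, then the coupled
chains meet at an exponential rate, with constants that depend on nothing else. -/
theorem exists_coupling_bound
    (hd : ∀ x y, ∫⁻ u, (V u : ℝ≥0∞) ∂(P (x, y)) ≤ (lam x : ℝ≥0∞) * V y + b x)
    (c₁ c₂ : ℕ+) (q n₀ : ℕ) :
    ∃ G κ : ℝ, 0 < G ∧ 0 < κ ∧ κ < 1 ∧ ∀ (z : ℤ → F) (reg : ℕ → Prop) [DecidablePred reg],
      (∀ m : ℕ, reg m → pastAt z (-m) ∈ regularPasts lam b η c₁ c₂) →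
      (∀ n, n ≤ (q + 1) * Nat.count reg n + n₀) →
      ∀ (n : ℕ) (w w' : E),
        (coupledLawFrom hV h (levelOf c₁) z n (w, w')).real {y | (y n).1 ≠ (y n).2} ≤
          G * (1 + V w + V w') * κ ^ n := by
  set D : ℕ := (q + 1) * c₁ with hD
  have hDpos : 0 < D := Nat.mul_pos q.succ_pos c₁.pos
  have hg0 : (0 : ℝ) < 1 - gap c₁ c₂ := sub_pos.2 (by exact_mod_cast gap_lt_one c₁ c₂)
  have hg1 : 1 - (gap c₁ c₂ : ℝ) < 1 := sub_lt_self _ (by exact_mod_cast gap_pos c₁ c₂)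
  set κ : ℝ := (1 - gap c₁ c₂ : ℝ) ^ ((D : ℝ)⁻¹) with hκ
  have hκ0 : 0 < κ := Real.rpow_pos_of_pos hg0 _
  have hκ1 : κ < 1 := Real.rpow_lt_one hg0.le hg1 (by positivity)
  have hκD : κ ^ D = 1 - gap c₁ c₂ := Real.rpow_inv_natCast_pow hg0.le hDpos.ne'
  -- One contraction is earned per `D` steps, apart from at most `n₀ + 2 D` steps, which the
  -- constant absorbs.
  refine ⟨(κ ^ (n₀ + 2 * D))⁻¹ * (1 + 2 * (c₁ : ℕ)), κ, by positivity, hκ0, hκ1, ?_⟩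
  intro z reg _ hreg hdens n w w'
  -- The last batch of visits is reserved for the initial stretch. Truncated subtraction gives `k =
  -- 0` for small `n`, where the bound is trivial.
  set k : ℕ := (n - n₀) / D - 1 with hk
  have hbound : evolve hV h (levelOf c₁) z (-n) n unmet (w, w') ≤
      ((1 - gap c₁ c₂ : ℝ≥0) : ℝ≥0∞) ^ k *
        ((1 + 2 * (c₁ : ℕ)) * (1 + pairLyapunov V (w, w'))) := by
    by_cases hL : (n - n₀) / D = 0
    · rw [hk, hL, Nat.zero_sub, pow_zero, one_mul]
      refine (evolve_unmet_le hV h _ z _ _ _).trans ((unmet_le_one _).trans ?_)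
      exact one_le_mul le_self_add le_self_add
    · refine evolve_unmet_le_pow hV h z hd reg hreg k n ?_ _
      have h1 : k + 1 = (n - n₀) / D := Nat.sub_add_cancel (Nat.one_le_iff_ne_zero.2 hL)
      have h2 : D * (k + 1) ≤ n - n₀ := by rw [h1]; exact Nat.mul_div_le _ _
      have h3 : (q + 1) * (c₁ * (k + 1)) ≤ (q + 1) * Nat.count reg n := by
        have := hdens n
        rw [← mul_assoc, ← hD]
        omega
      exact Nat.le_of_mul_le_mul_left h3 q.succ_pos
  have hn : n ≤ n₀ + 2 * D + D * k := by
    have h1 : n - n₀ < D * ((n - n₀) / D) + D := by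
      simpa [mul_add] using Nat.lt_mul_div_succ (n - n₀) hDpos
    have h2 : D * ((n - n₀) / D) ≤ D * (k + 1) := Nat.mul_le_mul_left _ le_tsub_add
    rw [mul_add] at h2
    omega
  rw [Measure.real, coupledLawFrom_ne]
  have hreal : (evolve hV h (levelOf c₁) z (-n) n unmet (w, w')).toReal ≤
      (1 - gap c₁ c₂ : ℝ) ^ k * ((1 + 2 * (c₁ : ℕ)) * (1 + (V w + V w'))) := by
    have hcast : ((1 - gap c₁ c₂ : ℝ≥0) : ℝ≥0∞) ^ k *
        ((1 + 2 * (c₁ : ℕ)) * (1 + pairLyapunov V (w, w'))) =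
        (((1 - gap c₁ c₂) ^ k * ((1 + 2 * (c₁ : ℕ)) * (1 + (V w + V w'))) : ℝ≥0) : ℝ≥0∞) := by
      simp only [pairLyapunov]
      push_cast
      rfl
    rw [hcast] at hbound
    refine (ENNReal.toReal_mono ENNReal.coe_ne_top hbound).trans_eq ?_
    rw [ENNReal.coe_toReal]
    push_cast [NNReal.coe_sub (gap_lt_one c₁ c₂).le]
    rfl
  refine hreal.trans ?_
  have hpow : (1 - gap c₁ c₂ : ℝ) ^ k ≤ (κ ^ (n₀ + 2 * D))⁻¹ * κ ^ n := by
    rw [← hκD, ← pow_mul, inv_mul_eq_div, le_div_iff₀ (by positivity), ← pow_add]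
    exact pow_le_pow_of_le_one hκ0.le hκ1.le (by omega)
  calc (1 - gap c₁ c₂ : ℝ) ^ k * ((1 + 2 * (c₁ : ℕ)) * (1 + (V w + V w')))
      ≤ (κ ^ (n₀ + 2 * D))⁻¹ * κ ^ n * ((1 + 2 * (c₁ : ℕ)) * (1 + (V w + V w'))) := by gcongr
    _ = _ := by ring

end Iteration

/-! ### Maximal Birkhoff sums and visit counts. -/

section BirkhoffMax

variable {α : Type*}

/-- The maximum of the Birkhoff sums `0, g, g + g ∘ T, …` of order at most `n`. -/
noncomputable def birkhoffMax (T : α → α) (g : α → ℝ) : ℕ → α → ℝ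
  | 0, _ => 0
  | n + 1, x => max 0 (g x + birkhoffMax T g n (T x))

theorem birkhoffMax_nonneg (T : α → α) (g : α → ℝ) (n : ℕ) (x : α) : 0 ≤ birkhoffMax T g n x := by
  cases n with
  | zero => exact le_rfl
  | succ n => exact le_max_left _ _

theorem birkhoffMax_le_succ (T : α → α) (g : α → ℝ) (n : ℕ) (x : α) :
    birkhoffMax T g n x ≤ birkhoffMax T g (n + 1) x := by
  induction n generalizing x with
  | zero => exact birkhoffMax_nonneg T g 1 x
  | succ n ih => exact max_le_max_left 0 (add_le_add_right (ih (T x)) (g x))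

theorem birkhoffSum_le_birkhoffMax (T : α → α) (g : α → ℝ) (n : ℕ) (x : α) :
    birkhoffSum T g n x ≤ birkhoffMax T g n x := by
  induction n generalizing x with
  | zero => simp [birkhoffMax]
  | succ n ih =>
    rw [birkhoffSum_succ']
    exact (add_le_add_right (ih (T x)) (g x)).trans (le_max_right _ _)

open Classical in
/-- The number of visits to `A` before time `n`. -/
noncomputable def visits (T : α → α) (A : Set α) (n : ℕ) (x : α) : ℕ :=
  Nat.count (fun k => T^[k] x ∈ A) n

theorem visits_succ (T : α → α) (A : Set α) (n : ℕ) (x : α) :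
    (visits T A (n + 1) x : ℝ) = A.indicator 1 x + visits T A n (T x) := by
  classical
  simp only [visits, Nat.count_succ', Function.iterate_succ, Function.comp_apply,
    Function.iterate_zero, id]
  by_cases hx : x ∈ A <;> simp [hx, add_comm] <;> congr

theorem visits_succ_le (T : α → α) (A : Set α) (n : ℕ) (x : α) :
    visits T A (n + 1) x ≤ visits T A n x + 1 := by
  classical
  simp only [visits, Nat.count_succ]
  split_ifs <;> omega

theorem visits_le_succ (T : α → α) (A : Set α) (n : ℕ) (x : α) :
    visits T A n x ≤ visits T A (n + 1) x := by
  classical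
  simp only [visits, Nat.count_succ]
  omega

theorem visits_apply_le (T : α → α) (A : Set α) (n : ℕ) (x : α) :
    visits T A n (T x) ≤ visits T A n x + 1 := by
  have h1 := visits_succ T A n x
  have h2 := visits_succ_le T A n x
  have h3 : (0 : ℝ) ≤ A.indicator 1 x := Set.indicator_nonneg (fun _ _ => zero_le_one) x
  have h4 : (visits T A n (T x) : ℝ) ≤ visits T A (n + 1) x := by linarith
  exact (by exact_mod_cast h4 : visits T A n (T x) ≤ visits T A (n + 1) x).trans h2

theorem visits_le_apply (T : α → α) (A : Set α) (n : ℕ) (x : α) :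
    visits T A n x ≤ visits T A n (T x) + 1 := by
  have h1 := visits_succ T A n x
  have h2 := visits_le_succ T A n x
  have h3 : A.indicator (1 : α → ℝ) x ≤ 1 := Set.indicator_le_self' (fun _ _ => zero_le_one) x
  have h4 : (visits T A (n + 1) x : ℝ) ≤ visits T A n (T x) + 1 := by linarith
  exact h2.trans (by exact_mod_cast h4)

/-- The points that do not visit `A` with a positive lower density. -/
def sparselyVisiting (T : α → α) (A : Set α) : Set α :=
  {x | ∀ q n₀ : ℕ, ∃ n, (q + 1) * visits T A n x + n₀ < n}

/-- Visit counts from `x` and `T x` differ by at most one; enlarging `n₀` by `q + 1` absorbs this.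
-/
theorem preimage_sparselyVisiting (T : α → α) (A : Set α) :
    T ⁻¹' sparselyVisiting T A = sparselyVisiting T A := by
  ext x
  constructor
  · intro hx q n₀
    obtain ⟨n, hn⟩ := hx q (n₀ + (q + 1))
    refine ⟨n, lt_of_le_of_lt ?_ hn⟩
    have := Nat.mul_le_mul_left (q + 1) (visits_le_apply T A n x)
    rw [mul_add] at this
    omega
  · intro hx q n₀
    obtain ⟨n, hn⟩ := hx q (n₀ + (q + 1))
    refine ⟨n, lt_of_le_of_lt ?_ hn⟩
    have := Nat.mul_le_mul_left (q + 1) (visits_apply_le T A n x)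
    rw [mul_add] at this
    omega

end BirkhoffMax

/-! ### The maximal ergodic theorem and positive density of visits. -/

section MaximalErgodic

variable {α : Type*} [MeasurableSpace α] {m : Measure α} {T : α → α}

theorem measurable_birkhoffMax (hT : Measurable T) {g : α → ℝ} (hg : Measurable g) (n : ℕ) :
    Measurable (birkhoffMax T g n) := by
  induction n with
  | zero => exact measurable_const
  | succ n ih => exact measurable_const.max (hg.add (ih.comp hT))

theorem integrable_birkhoffMax (hT : MeasurePreserving T m m) {g : α → ℝ} (hg : Integrable g m)
    (n : ℕ) : Integrable (birkhoffMax T g n) m := by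
  induction n with
  | zero => exact integrable_zero _ _ _
  | succ n ih =>
    exact (integrable_zero _ _ _).sup (hg.add ((hT.integrable_comp ih.aestronglyMeasurable).2 ih))

/-- Garsia's argument: where the maximum `M` is positive, `M - M ∘ T ≤ g`. Off that set `M` vanishes
while `M ∘ T ≥ 0`, and both have the same total integral. -/
theorem setIntegral_birkhoffMax_pos_nonneg (hT : MeasurePreserving T m m) {g : α → ℝ}
    (hgm : Measurable g) (hg : Integrable g m) (n : ℕ) :
    0 ≤ ∫ x in {x | 0 < birkhoffMax T g n x}, g x ∂m := by
  cases n with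
  | zero => simp [birkhoffMax]
  | succ n =>
    set M := birkhoffMax T g (n + 1) with hM
    set s := {x | 0 < M x} with hs
    have hMm : Measurable M := measurable_birkhoffMax hT.measurable hgm _
    have hsm : MeasurableSet s := measurableSet_lt measurable_const hMm
    have hMi : Integrable M m := integrable_birkhoffMax hT hg _
    have hMT : Integrable (M ∘ T) m := (hT.integrable_comp hMi.aestronglyMeasurable).2 hMi
    have hle : ∀ x ∈ s, M x - M (T x) ≤ g x := by
      intro x hx
      have h1 : M x = max 0 (g x + birkhoffMax T g n (T x)) := rfl
      have h2 : 0 < M x := hx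
      have h3 : M x = g x + birkhoffMax T g n (T x) := by
        rcases max_choice 0 (g x + birkhoffMax T g n (T x)) with h | h
        · rw [h1, h] at h2; exact absurd h2 (lt_irrefl _)
        · rw [h1, h]
      have := birkhoffMax_le_succ T g n (T x)
      rw [← hM] at this
      linarith
    have hint : ∫ x, M (T x) ∂m = ∫ x, M x ∂m := by
      have := integral_map (μ := m) hT.aemeasurable (f := M)
        (by rw [hT.map_eq]; exact hMi.aestronglyMeasurable)
      rw [hT.map_eq] at this
      exact this.symm
    have h1 : ∫ x in s, M x ∂m = ∫ x, M x ∂m :=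
      setIntegral_eq_integral_of_forall_compl_eq_zero fun x hx =>
        le_antisymm (not_lt.1 hx) (birkhoffMax_nonneg T g _ x)
    have h2 : ∫ x in s, M (T x) ∂m ≤ ∫ x, M (T x) ∂m :=
      setIntegral_le_integral hMT (ae_of_all _ fun x => birkhoffMax_nonneg T g _ _)
    calc (0 : ℝ) ≤ ∫ x in s, M x ∂m - ∫ x in s, M (T x) ∂m := by linarith
      _ = ∫ x in s, (M x - M (T x)) ∂m :=
        (integral_sub hMi.integrableOn hMT.integrableOn).symm
      _ ≤ ∫ x in s, g x ∂m :=
        setIntegral_mono_on (hMi.integrableOn.sub hMT.integrableOn) hg.integrableOn hsm hle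

/-- The maximal ergodic theorem. -/
theorem setIntegral_exists_birkhoffMax_pos_nonneg (hT : MeasurePreserving T m m) {g : α → ℝ}
    (hgm : Measurable g) (hg : Integrable g m) :
    0 ≤ ∫ x in ⋃ n, {x | 0 < birkhoffMax T g n x}, g x ∂m := by
  refine ge_of_tendsto' (tendsto_setIntegral_of_monotone (fun n => ?_) ?_ hg.integrableOn)
    (setIntegral_birkhoffMax_pos_nonneg hT hgm hg)
  · exact measurableSet_lt measurable_const (measurable_birkhoffMax hT.measurable hgm n)
  · exact monotone_nat_of_le_succ fun n x hx => lt_of_lt_of_le hx (birkhoffMax_le_succ T g n x)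

theorem measurable_visits (hT : Measurable T) {A : Set α} (hA : MeasurableSet A) (n : ℕ) :
    Measurable (visits T A n) := by
  classical
  induction n with
  | zero =>
    have : visits T A 0 = fun _ => 0 := by ext; simp [visits]
    rw [this]
    exact measurable_const
  | succ n ih =>
    have : visits T A (n + 1) = fun x => visits T A n x + if T^[n] x ∈ A then 1 else 0 := by
      ext x; simp [visits, Nat.count_succ]
    rw [this]
    exact ih.add (Measurable.ite ((hT.iterate n) hA) measurable_const measurable_const)

theorem measurableSet_sparselyVisiting (hT : Measurable T) {A : Set α} (hA : MeasurableSet A) :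
    MeasurableSet (sparselyVisiting T A) := by
  simp only [sparselyVisiting, Set.ofPred_forall, Set.ofPred_exists]
  refine MeasurableSet.iInter fun q => MeasurableSet.iInter fun n₀ =>
    MeasurableSet.iUnion fun n => ?_
  exact measurableSet_lt (((measurable_visits hT hA n).const_mul _).add_const _) measurable_const

/-- On the invariant set `B`, visits to `A` fall below any frequency `a > 0` at some time, so the
Birkhoff sums of `a 1_B - 1_{A ∩ B}` become positive. The maximal theorem gives `m (A ∩ B) ≤ a m B`,
and `a → 0`. -/
theorem measure_inter_sparselyVisiting [IsProbabilityMeasure m] (hT : MeasurePreserving T m m)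
    {A : Set α} (hA : MeasurableSet A) : m (A ∩ sparselyVisiting T A) = 0 := by
  set B := sparselyVisiting T A with hB
  have hBm : MeasurableSet B := measurableSet_sparselyVisiting hT.measurable hA
  have hinv (x : α) : T x ∈ B ↔ x ∈ B := by
    rw [← Set.mem_preimage, hB, preimage_sparselyVisiting]
  have key (q : ℕ) : m.real (A ∩ B) ≤ 1 / ((q : ℝ) + 1) := by
    set a : ℝ := 1 / ((q : ℝ) + 1) with ha
    set g : α → ℝ := fun x => a * B.indicator 1 x - (A ∩ B).indicator 1 x with hg
    have h1 : Integrable (B.indicator (1 : α → ℝ)) m := (integrable_const 1).indicator hBm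
    have h2 : Integrable ((A ∩ B).indicator (1 : α → ℝ)) m :=
      (integrable_const 1).indicator (hA.inter hBm)
    have hgm : Measurable g :=
      ((measurable_one.indicator hBm).const_mul a).sub (measurable_one.indicator (hA.inter hBm))
    have hgi : Integrable g m := (h1.const_mul a).sub h2
    have hsum (n : ℕ) (x : α) (hx : x ∈ B) : birkhoffSum T g n x = a * n - visits T A n x := by
      induction n generalizing x with
      | zero => simp [visits]
      | succ n ih =>
        rw [birkhoffSum_succ', ih (T x) ((hinv x).2 hx), visits_succ]
        have h3 : (A ∩ B).indicator (1 : α → ℝ) x = A.indicator 1 x := by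
          by_cases hxA : x ∈ A
          · rw [Set.indicator_of_mem hxA, Set.indicator_of_mem (Set.mem_inter hxA hx)]
          · rw [Set.indicator_of_notMem hxA, Set.indicator_of_notMem fun h => hxA h.1]
        simp only [hg, h3, Set.indicator_of_mem hx, Pi.one_apply]
        push_cast
        ring
    have hsub : B ⊆ ⋃ n, {x | 0 < birkhoffMax T g n x} := by
      intro x hx
      obtain ⟨n, hn⟩ := hx q 0
      refine Set.mem_iUnion.2 ⟨n, lt_of_lt_of_le ?_ (birkhoffSum_le_birkhoffMax T g n x)⟩
      rw [hsum n x hx, ha]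
      have h4 : ((q : ℝ) + 1) * visits T A n x < n := by exact_mod_cast hn
      rw [sub_pos, one_div_mul_eq_div, lt_div_iff₀ (by positivity)]
      linarith
    have hmax := setIntegral_exists_birkhoffMax_pos_nonneg hT hgm hgi
    rw [setIntegral_eq_integral_of_forall_compl_eq_zero] at hmax
    · rw [hg, integral_sub (h1.const_mul a) h2, integral_const_mul, integral_indicator_one hBm,
        integral_indicator_one (hA.inter hBm)] at hmax
      have h5 : a * m.real B ≤ a := mul_le_of_le_one_right (by positivity) measureReal_le_one
      linarith
    · intro x hx
      have hxB : x ∉ B := fun h => hx (hsub h)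
      simp [hg, hxB]
  have h0 : m.real (A ∩ B) ≤ 0 :=
    ge_of_tendsto' tendsto_one_div_add_atTop_nhds_zero_nat key
  exact (measureReal_eq_zero_iff).1 (le_antisymm h0 measureReal_nonneg)

end MaximalErgodic

/-! ### Positivity of conditional probabilities. -/

section CondProb

variable {Ω : Type*} {m mΩ : MeasurableSpace Ω} {μ : Measure Ω} [IsProbabilityMeasure μ]

/-- Almost surely, an event that occurs has a positive conditional probability. -/
theorem ae_condProb_pos_of_mem (hm : m ≤ mΩ) {A : Set Ω} (hA : MeasurableSet A) :
    ∀ᵐ ω ∂μ, ω ∈ A → 0 < (μ⟦A | m⟧) ω := by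
  set s : Set Ω := {ω | (μ⟦A | m⟧) ω ≤ 0} with hs
  have hsm : MeasurableSet[m] s :=
    (stronglyMeasurable_condExp (m := m) (μ := μ)
      (f := A.indicator fun _ => (1 : ℝ))).measurable measurableSet_Iic
  have hint : Integrable (A.indicator fun _ => (1 : ℝ)) μ := (integrable_const 1).indicator hA
  have h1 := setIntegral_condExp (μ := μ) hm hint hsm
  have h2 : ∫ ω in s, (μ⟦A | m⟧) ω ∂μ ≤ 0 :=
    setIntegral_nonpos (hm _ hsm) fun ω hω => hω
  have h3 : ∫ ω in s, A.indicator (fun _ => (1 : ℝ)) ω ∂μ = μ.real (A ∩ s) := by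
    rw [integral_indicator hA, Measure.restrict_restrict hA, setIntegral_const]
    simp
  have h4 : μ (A ∩ s) = 0 :=
    (measureReal_eq_zero_iff).1 (le_antisymm (by rw [← h3, ← h1]; exact h2) measureReal_nonneg)
  filter_upwards [measure_eq_zero_iff_ae_notMem.1 h4] with ω hω hωA
  by_contra hn
  exact hω ⟨hωA, not_lt.1 hn⟩

/-- An invariant event disjoint from `A` does not see the conditional probability of `A`. -/
theorem ae_notMem_of_condProb_pos (hm : m ≤ mΩ) {A B : Set Ω} (hA : MeasurableSet A)
    (hB : MeasurableSet[m] B) (hAB : μ (A ∩ B) = 0) :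
    ∀ᵐ ω ∂μ, 0 < (μ⟦A | m⟧) ω → ω ∉ B := by
  have hint : Integrable (A.indicator fun _ => (1 : ℝ)) μ := (integrable_const 1).indicator hA
  have h1 := setIntegral_condExp (μ := μ) hm hint hB
  have h3 : ∫ ω in B, A.indicator (fun _ => (1 : ℝ)) ω ∂μ = 0 := by
    rw [integral_indicator hA, Measure.restrict_restrict hA, setIntegral_const]
    simp [Measure.real, hAB]
  have hnn : 0 ≤ᵐ[μ] μ⟦A | m⟧ :=
    condExp_nonneg (ae_of_all _ fun ω => Set.indicator_nonneg (fun _ _ => zero_le_one) ω)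
  rw [h3, setIntegral_eq_zero_iff_of_nonneg_ae (ae_restrict_of_ae hnn)
    integrable_condExp.integrableOn] at h1
  filter_upwards [(ae_restrict_iff' (hm _ hB)).1 h1] with ω hω hpos hωB
  rw [hω hωB] at hpos
  exact lt_irrefl _ hpos

end CondProb

/-! ### Measurable selection from a countable cover. -/

section Selection

variable {Ω : Type*} {mΩ : MeasurableSpace Ω} {μ : Measure Ω}

/-- A countable family of events that cover almost everything admits a measurable selection. -/
theorem exists_measurable_selection {ι : Type*} [Countable ι] [Nonempty ι] (S : ι → Set Ω)
    (hS : ∀ i, MeasurableSet (S i)) (hcov : ∀ᵐ ω ∂μ, ∃ i, ω ∈ S i) :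
    ∃ j : Ω → ι, (@Measurable _ _ mΩ ⊤ j) ∧ ∀ᵐ ω ∂μ, ω ∈ S (j ω) := by
  classical
  obtain ⟨e, he⟩ := exists_surjective_nat ι
  -- The second alternative makes the search for the least index succeed on the uncovered null set
  -- too.
  have hp : ∀ ω, ∃ n, ω ∈ S (e n) ∨ ω ∉ ⋃ i, S i := by
    intro ω
    by_cases hω : ω ∈ ⋃ i, S i
    · obtain ⟨i, hi⟩ := Set.mem_iUnion.1 hω
      obtain ⟨n, rfl⟩ := he i
      exact ⟨n, Or.inl hi⟩
    · exact ⟨0, Or.inr hω⟩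
  refine ⟨fun ω => e (Nat.find (hp ω)), ?_, ?_⟩
  · have h1 : Measurable fun ω => Nat.find (hp ω) :=
      measurable_find hp fun k => (hS (e k)).union (MeasurableSet.iUnion hS).compl
    exact (@measurable_from_top ℕ ι ⊤ e).comp h1
  · filter_upwards [hcov] with ω hω
    exact (Nat.find_spec (hp ω)).resolve_right fun h => h (Set.mem_iUnion.2 hω)

end Selection

/-! ### The backward shift and regularity of a single past. -/

section Paths

variable {F : Type*}

theorem pastAt_zero (x : ℤ → F) : pastAt x 0 = fun j : ℕ => x (-(j : ℤ)) := by
  ext j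
  rw [pastAt, zero_sub]

/-- The shift to the past. -/
def pastShift (x : ℤ → F) : ℤ → F := fun t => x (t - 1)

theorem iterate_pastShift (m : ℕ) (x : ℤ → F) : pastShift^[m] x = fun t => x (t - m) := by
  induction m generalizing x with
  | zero => simp
  | succ m ih =>
    rw [Function.iterate_succ_apply, ih]
    ext t
    simp only [pastShift]
    congr 1
    push_cast
    ring

theorem preimage_shift_eq_of_preimage_pastShift_eq {B : Set (ℤ → F)}
    (hB : pastShift ⁻¹' B = B) : (fun (x : ℤ → F) (t : ℤ) => x (t + 1)) ⁻¹' B = B := by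
  nth_rw 1 [← hB]
  rw [← Set.preimage_comp]
  have : pastShift ∘ (fun (x : ℤ → F) (t : ℤ) => x (t + 1)) = id := by
    ext x t
    simp [pastShift]
  rw [this, Set.preimage_id]

/-- The paths with a regular past. -/
def regularPaths (lam b : F → ℝ≥0) (η : Level → F → ℝ≥0) (c : ℕ+ × ℕ+) : Set (ℤ → F) :=
  {x | pastAt x 0 ∈ regularPasts lam b η c.1 c.2}

theorem pastAt_mem_of_iterate_mem {lam b : F → ℝ≥0} {η : Level → F → ℝ≥0} {c : ℕ+ × ℕ+}
    {x : ℤ → F} {m : ℕ} (h : pastShift^[m] x ∈ regularPaths lam b η c) :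
    pastAt x (-m) ∈ regularPasts lam b η c.1 c.2 := by
  rw [iterate_pastShift] at h
  have hpast : pastAt (fun t => x (t - m)) 0 = pastAt x (-m) := by
    ext j
    simp only [pastAt]
    congr 1
    ring
  exact hpast ▸ h

/-- The products decay like `θ ^ n` and `b` grows at most like `exp (δ n)`; `θ exp δ < 1` makes the
series geometric. -/
theorem exists_mem_regularPasts {lam b : F → ℝ≥0} {η : Level → F → ℝ≥0}
    (hη : ∀ R x, 0 < η R x) {x : ℕ → F} {θ δ : ℝ} (hθ : 0 < θ)
    (hθδ : θ * Real.exp δ < 1) (hδ : 0 < δ)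
    (hlam : ∀ᶠ n : ℕ in atTop, ((∏ i ∈ Finset.Icc 1 n, lam (x i) : ℝ≥0) : ℝ) ≤ θ ^ n)
    (hb : ∀ᶠ n : ℕ in atTop, (b (x n) : ℝ) ≤ Real.exp (δ * n)) :
    ∃ c₁ c₂ : ℕ+, x ∈ regularPasts lam b η c₁ c₂ := by
  have hθ1 : θ < 1 := by
    have : 1 < Real.exp δ := Real.one_lt_exp_iff.2 hδ
    nlinarith
  have hsum : Summable fun i : ℕ => (∏ k ∈ Finset.Icc 1 i, lam (x k)) * b (x (i + 1)) := by
    rw [← NNReal.summable_coe]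
    refine Summable.of_norm_bounded_eventually_nat (g := fun i => (θ * Real.exp δ) ^ i * Real.exp δ)
      ((summable_geometric_of_lt_one (by positivity) hθδ).mul_right _) ?_
    filter_upwards [hlam, (tendsto_add_atTop_nat 1).eventually hb] with i h1 h2
    rw [Real.norm_of_nonneg (NNReal.coe_nonneg _), NNReal.coe_mul]
    calc _ ≤ θ ^ i * Real.exp (δ * (i + 1 : ℕ)) :=
          mul_le_mul h1 h2 (NNReal.coe_nonneg _) (by positivity)
      _ = (θ * Real.exp δ) ^ i * Real.exp δ := by
          rw [mul_pow, mul_assoc, ← Real.exp_nat_mul, ← Real.exp_add]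
          push_cast
          ring_nf
  obtain ⟨J, hJ⟩ := eventually_atTop.1 hlam
  obtain ⟨N₁, hN₁⟩ := exists_nat_ge (1 / (1 - θ))
  obtain ⟨N₂, hN₂⟩ := exists_nat_ge (∑' i : ℕ, (∏ k ∈ Finset.Icc 1 i, lam (x k)) * b (x (i + 1)))
  -- `J` is where the decay starts, `N₁` ensures `θ ≤ 1 - 1/c₁`, and `N₂` bounds the series. `c₂`
  -- comes afterwards, since the level in `η` depends on `c₁`.
  set c₁ : ℕ+ := ⟨J + N₁ + N₂ + 1, by omega⟩ with hc₁
  have hc : ((c₁ : ℕ+) : ℕ) = J + N₁ + N₂ + 1 := rfl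
  obtain ⟨c, hc₂⟩ := exists_nat_one_div_lt
    (show (0 : ℝ) < η (levelOf c₁) (x 0) from hη _ _)
  refine ⟨c₁, ⟨c + 1, by omega⟩, ?_, ?_, ?_⟩
  · intro j hj
    have hj0 : j ≠ 0 := by omega
    refine (hJ j (by omega)).trans ((pow_le_of_le_one hθ.le hθ1.le hj0).trans ?_)
    have h1 : (N₁ : ℝ) ≤ ((c₁ : ℕ+) : ℕ) := by exact_mod_cast (by omega : N₁ ≤ (c₁ : ℕ))
    have h2 : 1 / ((c₁ : ℕ) : ℝ) ≤ 1 - θ := by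
      have := one_div_le_one_div_of_le (one_div_pos.2 (sub_pos.2 hθ1)) (hN₁.trans h1)
      rwa [one_div_one_div] at this
    linarith
  · rw [← ENNReal.coe_tsum hsum]
    have h1 : N₂ ≤ (c₁ : ℕ) := by omega
    have h2 : (N₂ : ℝ≥0) ≤ ((c₁ : ℕ) : ℝ≥0) := by exact_mod_cast h1
    exact_mod_cast hN₂.trans h2
  · refine le_trans ?_ hc₂.le
    apply one_div_le_one_div_of_le (by positivity)
    simp

end Paths

/-! ### Measurability of the set of regular pasts. -/

section RegularPasts

variable {F : Type*} [MeasurableSpace F] {lam b : F → ℝ≥0} {η : Level → F → ℝ≥0}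

theorem measurableSet_regularPasts (hlam : Measurable lam) (hb : Measurable b)
    (hη : ∀ R, Measurable (η R)) (c₁ c₂ : ℕ+) : MeasurableSet (regularPasts lam b η c₁ c₂) := by
  have hprod (j : ℕ) : Measurable fun x : ℕ → F => ∏ i ∈ Finset.Icc 1 j, lam (x i) :=
    Finset.measurable_prod _ fun i _ => hlam.comp (measurable_pi_apply i)
  have hset : regularPasts lam b η c₁ c₂ =
      (⋂ j : ℕ, {x : ℕ → F | (c₁ : ℕ) ≤ j →
          ((∏ i ∈ Finset.Icc 1 j, lam (x i) : ℝ≥0) : ℝ) ≤ 1 - 1 / ((c₁ : ℕ) : ℝ)}) ∩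
        ({x | (∑' i : ℕ, ((∏ k ∈ Finset.Icc 1 i, lam (x k)) * b (x (i + 1)) : ℝ≥0) : ℝ≥0∞)
            ≤ ((c₁ : ℕ) : ℝ≥0∞)} ∩
          {x | 1 / (((c₂ : ℕ) : ℝ) + 1) ≤ (η (levelOf c₁) (x 0) : ℝ)}) := by
    ext x
    rw [Set.mem_inter_iff, Set.mem_iInter]
    rfl
  rw [hset]
  refine MeasurableSet.inter ?_ (MeasurableSet.inter ?_ ?_)
  · refine MeasurableSet.iInter fun j => ?_
    by_cases hj : (c₁ : ℕ) ≤ j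
    · simp only [hj, true_imp_iff]
      exact measurableSet_le (hprod j).coe_nnreal_real measurable_const
    · simp [hj]
  · refine measurableSet_le (Measurable.tsum fun i => ?_) measurable_const
    exact ((hprod i).mul (hb.comp (measurable_pi_apply (i + 1)))).coe_nnreal_ennreal
  · exact measurableSet_le measurable_const
      ((hη _).comp (measurable_pi_apply 0)).coe_nnreal_real

end RegularPasts

/-! ### The stationary environment: existence of admissible pairs and the random bound. -/

section Environment

variable {Ω E F : Type*} [MeasurableSpace Ω] [MeasurableSpace E] [MeasurableSpace F]
  {μ : Measure Ω} {X : ℤ → Ω → F}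

theorem IsStationary.measurable_path (hX : IsStationary μ X) : Measurable fun ω t => X t ω :=
  measurable_pi_lambda _ hX.measurable

theorem IsStationary.map_eq (hX : IsStationary μ X) (s : ℤ) : μ.map (X s) = μ.map (X 0) := by
  have h := congrArg (Measure.map fun x : ℤ → F => x 0) (hX.map_shift s)
  rw [Measure.map_map (measurable_pi_apply 0)
      (measurable_pi_lambda _ fun t => hX.measurable (t + s)),
    Measure.map_map (measurable_pi_apply 0) hX.measurable_path] at h
  simpa [Function.comp_def] using h

theorem IsStationary.measurePreserving_pastShift (hX : IsStationary μ X) :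
    MeasurePreserving pastShift (μ.map fun ω t => X t ω) (μ.map fun ω t => X t ω) := by
  have hm : Measurable (pastShift : (ℤ → F) → ℤ → F) :=
    measurable_pi_lambda _ fun t => measurable_pi_apply (t - 1)
  refine ⟨hm, ?_⟩
  rw [Measure.map_map hm hX.measurable_path, ← hX.map_shift (-1)]
  rfl

theorem invariantEvents_le (hX : IsStationary μ X) :
    invariantEvents X ≤ (inferInstance : MeasurableSpace Ω) := by
  rintro _ ⟨s, hs, rfl⟩
  exact hX.measurable_path hs.1

/-- A stationary process with integrable positive part grows sublinearly into the past. -/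
theorem IsStationary.ae_eventually_le_mul [IsProbabilityMeasure μ] (hX : IsStationary μ X)
    {f : F → ℝ} (hf : Measurable f) (hf0 : ∀ x, 0 ≤ f x) (hint : Integrable (fun ω => f (X 0 ω)) μ)
    {δ : ℝ} (hδ : 0 < δ) :
    ∀ᵐ ω ∂μ, ∀ᶠ n : ℕ in atTop, f (X (-(n : ℤ)) ω) ≤ δ * n := by
  -- Borel–Cantelli: stationarity turns the series into the tail sum of `f (X 0) / δ`, finite by
  -- integrability.
  have hsum : ∑' n : ℕ, μ {ω | f (X (-(n : ℤ)) ω) / δ ∈ Set.Ioi (n : ℝ)} ≠ ∞ := by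
    have h0 (n : ℕ) : μ {ω | f (X (-(n : ℤ)) ω) / δ ∈ Set.Ioi (n : ℝ)} =
        μ {ω | f (X 0 ω) / δ ∈ Set.Ioi (n : ℝ)} := by
      have hs : MeasurableSet {x | f x / δ ∈ Set.Ioi (n : ℝ)} :=
        (hf.div_const δ) measurableSet_Ioi
      have := congrArg (fun m => m {x | f x / δ ∈ Set.Ioi (n : ℝ)}) (hX.map_eq (-(n : ℤ)))
      simp only [Measure.map_apply (hX.measurable _) hs] at this
      exact this
    simp only [h0]
    let _ : MeasureSpace Ω := ⟨μ⟩
    have : IsProbabilityMeasure (volume : Measure Ω) := ‹IsProbabilityMeasure μ›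
    exact (tsum_prob_mem_Ioi_lt_top (hint.div_const δ) fun ω => div_nonneg (hf0 _) hδ.le).ne
  filter_upwards [ae_eventually_notMem hsum] with ω hω
  filter_upwards [hω] with n hn
  have h1 : f (X (-(n : ℤ)) ω) / δ ≤ n := not_lt.1 hn
  rw [div_le_iff₀ hδ] at h1
  linarith

theorem eventually_le_pow_of_limsup_lt_one {a : ℕ → ℝ≥0}
    (ha : limsup (fun n : ℕ => (a n : ℝ≥0∞) ^ (1 / (n : ℝ))) atTop < 1) :
    ∃ θ : ℝ, 0 < θ ∧ θ < 1 ∧ ∀ᶠ n in atTop, (a n : ℝ) ≤ θ ^ n := by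
  obtain ⟨θ, h1, h2⟩ := ENNReal.lt_iff_exists_nnreal_btwn.1 ha
  refine ⟨θ, ?_, by exact_mod_cast h2, ?_⟩
  · exact_mod_cast (zero_le.trans_lt h1 : (0 : ℝ≥0∞) < θ)
  · filter_upwards [eventually_lt_of_limsup_lt h1, eventually_ne_atTop 0] with n hn hn0
    have h3 : ((a n : ℝ≥0∞) ^ (1 / (n : ℝ))) ^ n ≤ (θ : ℝ≥0∞) ^ n := pow_le_pow_left' hn.le n
    rw [one_div, ENNReal.rpow_inv_natCast_pow hn0] at h3
    exact_mod_cast h3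

variable {P : Kernel (F × E) E} {V : E → ℝ≥0} {lam b : F → ℝ≥0}
  {η : Level → F → ℝ≥0} {ν : Level → Kernel F E}

theorem MinorizationAssumption.measurable_eta_apply (hmin : MinorizationAssumption P V η ν)
    (R : Level) : Measurable (η R) :=
  hmin.measurable_eta.comp measurable_prodMk_left

/-- Almost every past is regular. -/
theorem ae_exists_regular [IsProbabilityMeasure μ] (hX : IsStationary μ X)
    (hdrift : DriftAssumption μ X P V lam b) (hmin : MinorizationAssumption P V η ν) :
    ∀ᵐ ω ∂μ, ∃ c : ℕ+ × ℕ+, (fun j : ℕ => X (-(j : ℤ)) ω) ∈ regularPasts lam b η c.1 c.2 := by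
  -- Countably many growth rates share one null set, because the rate needed depends on the random
  -- `θ`.
  have hlog : ∀ᵐ ω ∂μ, ∀ k : ℕ, ∀ᶠ n : ℕ in atTop,
      Real.log (max (b (X (-(n : ℤ)) ω) : ℝ) 1) ≤ 1 / ((k : ℝ) + 1) * n :=
    ae_all_iff.2 fun k => hX.ae_eventually_le_mul
      (f := fun x => Real.log (max (b x : ℝ) 1))
      (Real.measurable_log.comp (hdrift.measurable_b.coe_nnreal_real.max measurable_const))
      (fun x => Real.log_nonneg (le_max_right _ _)) hdrift.integrable_log_b (by positivity)
  filter_upwards [hlog, hdrift.limsup_lt_one] with ω hω hlim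
  obtain ⟨θ, hθ0, hθ1, hθ⟩ := eventually_le_pow_of_limsup_lt_one hlim
  obtain ⟨k, hk⟩ := exists_nat_one_div_lt (neg_pos.2 (Real.log_neg hθ0 hθ1))
  have hθδ : θ * Real.exp (1 / ((k : ℝ) + 1)) < 1 := by
    nth_rw 1 [← Real.exp_log hθ0]
    rw [← Real.exp_add, Real.exp_lt_one_iff]
    linarith
  obtain ⟨c₁, c₂, hc⟩ := exists_mem_regularPasts (lam := lam) (b := b) (η := η)
    (x := fun j : ℕ => X (-(j : ℤ)) ω) hmin.eta_pos hθ0 hθδ (by positivity) hθ (by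
      filter_upwards [hω k] with n hn
      refine (le_max_left _ 1).trans ?_
      exact (Real.log_le_iff_le_exp (lt_max_of_lt_right one_pos)).1 hn)
  exact ⟨(c₁, c₂), hc⟩

theorem measurableSet_regularEvent (hX : IsStationary μ X)
    (hdrift : DriftAssumption μ X P V lam b) (hmin : MinorizationAssumption P V η ν)
    (c₁ c₂ : ℕ+) :
    MeasurableSet {ω | (fun j : ℕ => X (-(j : ℤ)) ω) ∈ regularPasts lam b η c₁ c₂} :=
  (measurable_pi_lambda _ fun j : ℕ => hX.measurable (-(j : ℤ)))
    (measurableSet_regularPasts hdrift.measurable_lam hdrift.measurable_b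
      hmin.measurable_eta_apply c₁ c₂)

theorem exists_isRegularitySelection [IsProbabilityMeasure μ] (hX : IsStationary μ X)
    (hdrift : DriftAssumption μ X P V lam b) (hmin : MinorizationAssumption P V η ν) :
    ∃ C₁ C₂ : Ω → ℕ+, IsRegularitySelection μ X lam b η C₁ C₂ := by
  have hm := invariantEvents_le hX
  have hpos : ∀ᵐ ω ∂μ, ∃ c : ℕ+ × ℕ+,
      ω ∈ {ω | 0 < condProbPast μ X (regularPasts lam b η c.1 c.2) ω} := by
    have h1 : ∀ᵐ ω ∂μ, ∀ c : ℕ+ × ℕ+,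
        (fun j : ℕ => X (-(j : ℤ)) ω) ∈ regularPasts lam b η c.1 c.2 →
          0 < condProbPast μ X (regularPasts lam b η c.1 c.2) ω :=
      ae_all_iff.2 fun c => ae_condProb_pos_of_mem hm
        (measurableSet_regularEvent hX hdrift hmin c.1 c.2)
    filter_upwards [h1, ae_exists_regular hX hdrift hmin] with ω hω hc
    obtain ⟨c, hc⟩ := hc
    exact ⟨c, hω c hc⟩
  obtain ⟨C, hC, hCpos⟩ := exists_measurable_selection
    (fun c : ℕ+ × ℕ+ => {ω | 0 < condProbPast μ X (regularPasts lam b η c.1 c.2) ω})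
    (fun c => measurableSet_lt measurable_const
      (stronglyMeasurable_condExp.measurable.mono hm le_rfl)) hpos
  exact ⟨fun ω => (C ω).1, fun ω => (C ω).2,
    (@measurable_from_top _ _ _ fun c : ℕ+ × ℕ+ => (c.1 : ℕ)).comp hC,
    (@measurable_from_top _ _ _ fun c : ℕ+ × ℕ+ => (c.2 : ℕ)).comp hC, hCpos⟩

theorem measurableSet_regularPaths (hdrift : DriftAssumption μ X P V lam b)
    (hmin : MinorizationAssumption P V η ν) (c : ℕ+ × ℕ+) :
    MeasurableSet (regularPaths lam b η c) :=
  (measurable_pi_lambda _ fun j : ℕ => measurable_pi_apply ((0 : ℤ) - j))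
    (measurableSet_regularPasts hdrift.measurable_lam hdrift.measurable_b
      hmin.measurable_eta_apply c.1 c.2)

/-- Where regularity has a positive conditional probability, regular times have a positive lower
density in the past. -/
theorem ae_notMem_sparselyVisiting [IsProbabilityMeasure μ] (hX : IsStationary μ X)
    (hdrift : DriftAssumption μ X P V lam b) (hmin : MinorizationAssumption P V η ν)
    (c : ℕ+ × ℕ+) :
    ∀ᵐ ω ∂μ, 0 < condProbPast μ X (regularPasts lam b η c.1 c.2) ω →
      (fun t => X t ω) ∉ sparselyVisiting pastShift (regularPaths lam b η c) := by
  have hA := measurableSet_regularPaths hdrift hmin c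
  have hT := hX.measurePreserving_pastShift
  have hB := measurableSet_sparselyVisiting hT.measurable hA
  have : IsProbabilityMeasure (μ.map fun ω t => X t ω) :=
    Measure.isProbabilityMeasure_map hX.measurable_path.aemeasurable
  have h0 := measure_inter_sparselyVisiting hT hA
  rw [Measure.map_apply hX.measurable_path (hA.inter hB), Set.preimage_inter] at h0
  have hset : (fun ω t => X t ω) ⁻¹' regularPaths lam b η c =
      {ω | (fun j : ℕ => X (-(j : ℤ)) ω) ∈ regularPasts lam b η c.1 c.2} := by
    ext ω
    simp [regularPaths, pastAt_zero]
  rw [hset] at h0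
  exact ae_notMem_of_condProb_pos (invariantEvents_le hX)
    (measurableSet_regularEvent hX hdrift hmin c.1 c.2)
    ⟨_, ⟨hB, preimage_shift_eq_of_preimage_pastShift_eq (preimage_sparselyVisiting _ _)⟩, rfl⟩ h0

variable [TopologicalSpace E] [PolishSpace E] [BorelSpace E]

/-- The deterministic constants depend only on `(c₁, c₂, q, n₀)`, where `q, n₀` quantify the density
of regular times. A measurable choice of these integers makes `G` and `κ` measurable. -/
theorem exists_random_coupling_bound [IsProbabilityMeasure μ] [IsMarkovKernel P]
    (hX : IsStationary μ X) (hdrift : DriftAssumption μ X P V lam b)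
    (hmin : MinorizationAssumption P V η ν) {C₁ C₂ : Ω → ℕ+}
    (hC : IsRegularitySelection μ X lam b η C₁ C₂) :
    ∃ G κ : Ω → ℝ, Measurable G ∧ Measurable κ ∧ (∀ ω, 0 < G ω) ∧ (∀ ω, 0 < κ ω ∧ κ ω < 1) ∧
      ∀ᵐ ω ∂μ, ∀ n : ℕ, 1 ≤ n → ∀ z z' : E,
        (coupledLawFrom hdrift.measurable_V hmin (levelOf (C₁ ω)) (fun t => X t ω) n (z, z')).real
          {y | (y n).1 ≠ (y n).2} ≤ G ω * (1 + V z + V z') * κ ω ^ n := by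
  classical
  choose G κ hG hκ0 hκ1 hbound using fun c : ℕ+ × ℕ+ => fun q n₀ : ℕ =>
    exists_coupling_bound (lam := lam) (b := b) hdrift.measurable_V hmin hdrift.drift c.1 c.2 q n₀
  have hT : Measurable (pastShift : (ℤ → F) → ℤ → F) := hX.measurePreserving_pastShift.measurable
  set S : (ℕ+ × ℕ+) × ℕ × ℕ → Set Ω := fun i =>
    {ω | (C₁ ω : ℕ) = i.1.1} ∩ {ω | (C₂ ω : ℕ) = i.1.2} ∩
    {ω | ∀ n, n ≤ (i.2.1 + 1) * visits pastShift (regularPaths lam b η i.1) n (fun t => X t ω) +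
      i.2.2} with hS
  have hSm (i) : MeasurableSet (S i) := by
    refine ((hC.measurable_fst (measurableSet_singleton _)).inter
      (hC.measurable_snd (measurableSet_singleton _))).inter ?_
    simp only [Set.ofPred_forall]
    refine MeasurableSet.iInter fun n => measurableSet_le measurable_const ?_
    exact ((((measurable_visits hT (measurableSet_regularPaths hdrift hmin i.1) n).comp
      hX.measurable_path).const_mul _).add_const _)
  -- The density statement holds for all `c` off one null set, so the random pair `(C₁ ω, C₂ ω)` may
  -- be substituted.
  have hcov : ∀ᵐ ω ∂μ, ∃ i, ω ∈ S i := by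
    filter_upwards [hC.condProb_pos,
      ae_all_iff.2 fun c => ae_notMem_sparselyVisiting hX hdrift hmin c] with ω hpos hω
    have h1 := hω (C₁ ω, C₂ ω) hpos
    simp only [sparselyVisiting, Set.mem_ofPred_eq, not_forall, not_exists, not_lt] at h1
    obtain ⟨q, n₀, hn⟩ := h1
    exact ⟨((C₁ ω, C₂ ω), q, n₀), ⟨rfl, rfl⟩, hn⟩
  obtain ⟨j, hj, hjS⟩ := exists_measurable_selection S hSm hcov
  refine ⟨fun ω => G (j ω).1 (j ω).2.1 (j ω).2.2, fun ω => κ (j ω).1 (j ω).2.1 (j ω).2.2,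
    (@measurable_from_top _ _ _ fun i : (ℕ+ × ℕ+) × ℕ × ℕ => G i.1 i.2.1 i.2.2).comp hj,
    (@measurable_from_top _ _ _ fun i : (ℕ+ × ℕ+) × ℕ × ℕ => κ i.1 i.2.1 i.2.2).comp hj,
    fun ω => hG _ _ _, fun ω => ⟨hκ0 _ _ _, hκ1 _ _ _⟩, ?_⟩
  filter_upwards [hjS] with ω hω n _ z z'
  obtain ⟨⟨h1, _⟩, hn⟩ := hω
  have h1' : C₁ ω = (j ω).1.1 := PNat.coe_injective h1
  rw [h1']
  exact hbound (j ω).1 (j ω).2.1 (j ω).2.2 (fun t => X t ω) _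
    (fun m hm => pastAt_mem_of_iterate_mem hm) hn n z z'

end Environment

end RandomEnvironment

theorem mainTheorem4 {Ω E F : Type*} [MeasurableSpace Ω]
    [TopologicalSpace E] [PolishSpace E] [MeasurableSpace E] [BorelSpace E]
    [TopologicalSpace F] [PolishSpace F] [MeasurableSpace F] [BorelSpace F]
    (μ : Measure Ω) [IsProbabilityMeasure μ] (X : ℤ → Ω → F)
    (P : Kernel (F × E) E) [IsMarkovKernel P]
    (V : E → ℝ≥0) (lam b : F → ℝ≥0)
    (η : RandomEnvironment.Level → F → ℝ≥0) (ν : RandomEnvironment.Level → Kernel F E)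
    (hX : RandomEnvironment.IsStationary μ X)
    (hdrift : RandomEnvironment.DriftAssumption μ X P V lam b)
    (hmin : RandomEnvironment.MinorizationAssumption P V η ν) :
    (∃ C₁ C₂ : Ω → ℕ+, RandomEnvironment.IsRegularitySelection μ X lam b η C₁ C₂) ∧
    ∀ C₁ C₂ : Ω → ℕ+, RandomEnvironment.IsRegularitySelection μ X lam b η C₁ C₂ →
      ∃ G κ : Ω → ℝ, Measurable G ∧ Measurable κ ∧ (∀ ω, 0 < G ω) ∧
        (∀ ω, 0 < κ ω ∧ κ ω < 1) ∧
        ∀ᵐ ω ∂μ, ∀ n : ℕ, 1 ≤ n → ∀ z z' : E,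
          (RandomEnvironment.coupledLawFrom hdrift.measurable_V hmin
              (RandomEnvironment.levelOf (C₁ ω)) (fun t => X t ω) n (z, z')).real
            {y | (y n).1 ≠ (y n).2} ≤ G ω * (1 + V z + V z') * κ ω ^ n :=
  ⟨RandomEnvironment.exists_isRegularitySelection hX hdrift hmin, fun _ _ hC =>
    RandomEnvironment.exists_random_coupling_bound hX hdrift hmin hC⟩
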